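/- Let $a<b$. A partition of $[a,b]$ is a sequence $X=(x_j:0\le j\le N)$ with $a=x_0<\cdots<x_N=b$; put $h_j=x_j-x_{j-1}$, $\overline h=\overline h(X)=\max_j h_j$ and let $|X|=\overline h/\min_j h_j$ be its mesh ratio. For $\alpha>0$ let $S_\alpha^2(X)$ be the set of all $s\in C^2[a,b]$ with $(D^2-\alpha^2)^2s=0$ on $[a,b]\setminus X$, and let $T_\alpha^2(X)=\{\operatorname{sech}(\alpha\,\cdot)\,u: u\in S_\alpha^2(X)\}$. For $f\in C^4[a,b]$, an element $s$ of $S_\alpha^2(X)$ or of $T_\alpha^2(X)$ interpolates $f$ on $X$ with end conditions of type I, II or III if $s(x_j)=f(x_j)$ for all $0\le j\le N$ and, respectively, - Type I: $s'(a)=f'(a)$ and $s'(b)=f'(b)$; - Type II: $s''(a)=s''(b)=0$; - Type III: $s''(a)=f''(a)$ and $s''(b)=f''(b)$. **Corollary.** Let $f\in C^4[a,b]$. There is $\alpha_0>0$ such that the following holds for all $0<\alpha<\alpha_0$. 1. For every partition $X$ of $[a,b]$ and each of the types I, II, III there are exactly one interpolant $t_\alpha[f]\in T_\alpha^2(X)$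 and exactly one interpolant $s_\alpha[f]\in S_\alpha^2(X)$ of $f$ on $X$ with end conditions of that type, and there is a constant $C=C_{\alpha,f,X}>0$ with $$\|D^i(t_\alpha[f]-f)\|_{L^\infty[a,b]}\le C\,\overline h^{\,4-i},\qquad \|D^i(s_\alpha[f]-f)\|_{L^\infty[a,b]}\le C\,\overline h^{\,4-i},\qquad i=0,1,2.$$ 2. For the types I and III, and for type II if $f''(a)=f''(b)=0$, the constant depends on $X$ only through its mesh ratio: for every $\rho$ there is a constant $C=C_{\alpha,f,\rho}>0$ such that these bounds hold with this $C$ for all partitions $X$ of $[a,b]$ with $|X|\le\rho$. -/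

import Mathlib

open Set MeasureTheory

noncomputable section

/-- A partition `a = x 0 < x 1 < ⋯ < x N = b` of the interval `[a, b]`. -/
structure IntervalPartition (a b : ℝ) where
  /-- the number of subintervals -/
  N : ℕ
  /-- the nodes -/
  x : Fin (N + 1) → ℝ
  strictMono : StrictMono x
  first : x 0 = a
  last : x (Fin.last N) = b

namespace IntervalPartition

variable {a b : ℝ}

/-- The length of the `j`-th subinterval. -/
def step (X : IntervalPartition a b) (j : Fin X.N) : ℝ := X.x j.succ - X.x j.castSucc

/-- The mesh size: the largest step. -/
def meshSize (X : IntervalPartition a b) : ℝ := ⨆ j, X.step j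

/-- The smallest step. -/
def minStep (X : IntervalPartition a b) : ℝ := ⨅ j, X.step j

/-- The mesh ratio: the largest step divided by the smallest one. -/
def meshRatio (X : IntervalPartition a b) : ℝ := X.meshSize / X.minStep

end IntervalPartition

/-- The differential operator `D² - α²`. -/
def hypOp (α : ℝ) (u : ℝ → ℝ) : ℝ → ℝ := fun x => iteratedDeriv 2 u x - α ^ 2 * u x

/-- The `k`-th order polyhyperbolic splines (`1 ≤ k`): the functions of class `C^(2k-2)` on
`[a, b]` which are classical solutions of `(D² - α²)^k s = 0` on `[a, b] \ X`. The set
`[a, b] \ X` is open, since `a` and `b` are nodes. -/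
def polyhyperbolicSpline (α : ℝ) (k : ℕ) {a b : ℝ} (X : IntervalPartition a b) :
    Set (ℝ → ℝ) :=
  {s | ContDiffOn ℝ ((2 * k - 2 : ℕ) : WithTop ℕ∞) s (Icc a b) ∧
    ContDiffOn ℝ ((2 * k : ℕ) : WithTop ℕ∞) s (Icc a b \ range X.x) ∧
    ∀ x ∈ Icc a b \ range X.x, ((hypOp α)^[k] s) x = 0}

/-- The `k`-th order hyperbolic tangent splines: the products `sech (α x) * u x` with `u` a
`k`-th order polyhyperbolic spline. Between nodes they have the form `p + q tanh (α x)`. -/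
def tanhSpline (α : ℝ) (k : ℕ) {a b : ℝ} (X : IntervalPartition a b) : Set (ℝ → ℝ) :=
  {t | ∃ u ∈ polyhyperbolicSpline α k X, t = fun x => (Real.cosh (α * x))⁻¹ * u x}

/-- The three types of end conditions. -/
inductive EndType
  | I
  | II
  | III

/-- The end conditions on `s` for sampling `f`; derivatives at `a` and `b` are one-sided. -/
def EndCondition (a b : ℝ) (f s : ℝ → ℝ) : EndType → Prop
  | .I => iteratedDerivWithin 1 s (Icc a b) a = iteratedDerivWithin 1 f (Icc a b) a ∧
      iteratedDerivWithin 1 s (Icc a b) b = iteratedDerivWithin 1 f (Icc a b) b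
  | .II => iteratedDerivWithin 2 s (Icc a b) a = 0 ∧ iteratedDerivWithin 2 s (Icc a b) b = 0
  | .III => iteratedDerivWithin 2 s (Icc a b) a = iteratedDerivWithin 2 f (Icc a b) a ∧
      iteratedDerivWithin 2 s (Icc a b) b = iteratedDerivWithin 2 f (Icc a b) b

/-- `s` belongs to the spline space `V`, agrees with `f` at all nodes of `X`, and satisfies the
end conditions of type `e`. -/
def IsInterpolant (V : Set (ℝ → ℝ)) {a b : ℝ} (X : IntervalPartition a b) (e : EndType)
    (f s : ℝ → ℝ) : Prop :=
  s ∈ V ∧ (∀ j, s (X.x j) = f (X.x j)) ∧ EndCondition a b f s e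

/-- There is an interpolant of `f` in `V`, and it is unique as a function on `[a, b]`. -/
def UniquelyInterpolable (V : Set (ℝ → ℝ)) {a b : ℝ} (X : IntervalPartition a b) (e : EndType)
    (f : ℝ → ℝ) : Prop :=
  (∃ s, IsInterpolant V X e f s) ∧
    ∀ s s', IsInterpolant V X e f s → IsInterpolant V X e f s' → EqOn s s' (Icc a b)

/-- The norm `‖D^i u‖` in `L^∞[a, b]`. -/
def derivSupNorm (a b : ℝ) (i : ℕ) (u : ℝ → ℝ) : ENNReal :=
  eLpNorm (iteratedDerivWithin i u (Icc a b)) ⊤ (volume.restrict (Icc a b))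

/-- `‖D^i (s - f)‖ ≤ C * h^(4-i)` in `L^∞[a, b]` for `i = 0, 1, 2` and the interpolant `s` of `f`
in `V`, where `h` is the mesh size of `X`. -/
def InterpolationBound (V : Set (ℝ → ℝ)) {a b : ℝ} (X : IntervalPartition a b) (e : EndType)
    (f : ℝ → ℝ) (C : ℝ) : Prop :=
  ∀ s, IsInterpolant V X e f s → ∀ i : ℕ, i ≤ 2 →
    derivSupNorm a b i (s - f) ≤ ENNReal.ofReal (C * X.meshSize ^ (4 - i))

end

/-! Both spline spaces have the form `w * u` with `u` a polyhyperbolic spline and `w` equal to `1`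
or to `sech (α x)`. If `w * u` interpolates `f`, then `e = u - f / w` vanishes at all nodes, and off
the nodes `(D² - α²)² e = -(D² - α²)² (f / w)`, which is bounded by a number `K` that knows nothing
of the partition. When `f` itself satisfies the end conditions, those for `w * e` are homogeneous,
so at each end either `e' = 0` or, since `e = 0` and `|w'| ≤ α w` there, `|e''| ≤ 2α |e'|`.

The core is `IntervalPartition.spline_error_estimate`, the moment method for cubic splines in
perturbed form. The function `r = e'' - α² e` is close to its chord on each subinterval, and so is
`e''` to the chord of `r`. Integrating twice between the zeros of `e` expresses the two end slopes
of `e` by the nodal values of `r`, up to a small error. Equality of the slopes from the left and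
from the right at a node is a tridiagonal system with diagonal weight 1/3 against off-diagonal
weight 1/6 on each adjacent step, so it is dominant by the same factor whatever the two steps are.
At a node where `|r|` is largest among the nodes this bounds `r`; for small `α (b - a)` the
remaining terms are absorbed, giving `|e''| ≤ K h²` and then the bounds for `e'` and `e`.

With `K = 0` the estimate says that homogeneous data force the zero spline. This is uniqueness, and
existence follows because a basis of truncated kernels has `N + 3` elements, as many as there are
data. Once the interpolant is unique, a constant depending on the partition exists by compactness,
whatever the end conditions of `f`. -/

/-! ### Chord and slope estimates on one interval. -/

/-- Error of linear interpolation, one-sided version. -/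
theorem le_chord_add_of_second_deriv_ge {p q M : ℝ} {r r1 r2 : ℝ → ℝ}
    (hr : ContinuousOn r (Icc p q)) (hr1 : ∀ x ∈ Ioo p q, HasDerivAt r (r1 x) x)
    (hr2 : ∀ x ∈ Ioo p q, HasDerivAt r1 (r2 x) x) (hM : ∀ x ∈ Ioo p q, -M ≤ r2 x)
    {x : ℝ} (hx : x ∈ Icc p q) :
    (q - p) * r x ≤ r p * (q - x) + r q * (x - p) + M * ((x - p) * (q - x) * (q - p)) / 2 := by
  -- Adding the parabola makes the function convex, hence below its chord; the parabola lies below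
  -- its own chord by `M (x - p) (q - x) / 2`.
  have hconv : ConvexOn ℝ (Icc p q) (fun x => r x + M * x ^ 2 / 2) := by
    refine convexOn_of_hasDerivWithinAt2_nonneg (f' := fun x => r1 x + M * x)
      (f'' := fun x => r2 x + M) (convex_Icc p q) (by fun_prop) ?_ ?_ ?_
    · intro y hy
      rw [interior_Icc] at hy
      have h1 : HasDerivAt (fun x : ℝ => M * x ^ 2 / 2) (M * y) y :=
        ((((hasDerivAt_id y).pow 2).const_mul M).div_const 2).congr_deriv (by
          push_cast; simp only [id]; ring)
      exact ((hr1 y hy).add h1).hasDerivWithinAt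
    · intro y hy
      rw [interior_Icc] at hy
      have h1 : HasDerivAt (fun x : ℝ => M * x) M y := by
        simpa using (hasDerivAt_id y).const_mul M
      exact ((hr2 y hy).add h1).hasDerivWithinAt
    · intro y hy
      rw [interior_Icc] at hy
      linarith [hM y hy]
  rcases (hx.1.trans hx.2).eq_or_lt with hpq | hpq
  · have : x = p := le_antisymm (hpq ▸ hx.2) hx.1
    subst this; subst hpq; simp
  have hpos : 0 < q - p := sub_pos.2 hpq
  have h := hconv.2 (left_mem_Icc.2 hpq.le) (right_mem_Icc.2 hpq.le)
    (div_nonneg (sub_nonneg.2 hx.2) hpos.le) (div_nonneg (sub_nonneg.2 hx.1) hpos.le)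
    (by field_simp; ring)
  have hxe : ((q - x) / (q - p)) • p + ((x - p) / (q - p)) • q = x := by
    simp only [smul_eq_mul]; field_simp; ring
  rw [hxe] at h
  simp only [smul_eq_mul] at h
  have h2 := mul_le_mul_of_nonneg_left h hpos.le
  have h3 : (q - p) * ((q - x) / (q - p) * (r p + M * p ^ 2 / 2) +
      (x - p) / (q - p) * (r q + M * q ^ 2 / 2)) =
      (q - x) * (r p + M * p ^ 2 / 2) + (x - p) * (r q + M * q ^ 2 / 2) := by
    field_simp
  rw [h3] at h2
  nlinarith [h2]

/-- Error of linear interpolation. -/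
theorem abs_sub_chord_le {p q M : ℝ} (hpq : p < q) {r r1 r2 : ℝ → ℝ}
    (hr : ContinuousOn r (Icc p q)) (hr1 : ∀ x ∈ Ioo p q, HasDerivAt r (r1 x) x)
    (hr2 : ∀ x ∈ Ioo p q, HasDerivAt r1 (r2 x) x) (hM : ∀ x ∈ Ioo p q, |r2 x| ≤ M)
    {x : ℝ} (hx : x ∈ Icc p q) :
    |r x - (r p * (q - x) + r q * (x - p)) / (q - p)| ≤ M * (q - p) ^ 2 / 8 := by
  have hpos : 0 < q - p := sub_pos.2 hpq
  have hM0 : 0 ≤ M := (abs_nonneg _).trans (hM ((p + q) / 2) ⟨by linarith, by linarith⟩)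
  have h1 := le_chord_add_of_second_deriv_ge hr hr1 hr2 (fun x hx => (abs_le.1 (hM x hx)).1) hx
  have h2 := le_chord_add_of_second_deriv_ge hr.neg (fun x hx => (hr1 x hx).neg)
    (fun x hx => (hr2 x hx).neg) (M := M)
    (fun x hx => by linarith [(abs_le.1 (hM x hx)).2]) hx
  simp only [Pi.neg_apply] at h2
  have h3 : M * ((x - p) * (q - x)) ≤ M * ((q - p) ^ 2 / 4) :=
    mul_le_mul_of_nonneg_left (by nlinarith [sq_nonneg (q + p - 2 * x)]) hM0
  have h4 := mul_le_mul_of_nonneg_right h3 hpos.le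
  set c := (r p * (q - x) + r q * (x - p)) / (q - p) with hc
  have hc' : r p * (q - x) + r q * (x - p) = c * (q - p) := by rw [hc]; field_simp
  rw [abs_le]
  constructor <;> refine le_of_mul_le_mul_right ?_ hpos <;> nlinarith

/-- The slope at the right end of an interval of a function vanishing at both ends. -/
theorem abs_right_slope_sub_le {p q η A B : ℝ} (hpq : p < q) {e e1 e2 : ℝ → ℝ}
    (he : ContinuousOn e (Icc p q)) (he1 : ContinuousOn e1 (Icc p q))
    (hd : ∀ x ∈ Ioo p q, HasDerivAt e (e1 x) x) (hd1 : ∀ x ∈ Ioo p q, HasDerivAt e1 (e2 x) x)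
    (hp : e p = 0) (hq : e q = 0)
    (h2 : ∀ x ∈ Ioo p q, |e2 x - (A * (q - x) + B * (x - p)) / (q - p)| ≤ η) :
    |e1 q - (q - p) * (B / 3 + A / 6)| ≤ η * (q - p) / 2 := by
  have hpos : 0 < q - p := sub_pos.2 hpq
  -- The sign `σ` treats the upper and the lower bound together.
  have key : ∀ σ : ℝ, |σ| = 1 →
      σ * (e1 q - (q - p) * (B / 3 + A / 6)) ≤ η * (q - p) / 2 := by
    intro σ hσ
    -- Integration by parts: `(x - p) e' - e` has derivative `(x - p) e''` and takes the value `(q -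
    -- p) e' q` at `q`. `P` is the primitive of `x - p` times the chord with end values `A` and `B`.
    let P : ℝ → ℝ := fun x => (A * ((x - p) ^ 2 * (q - p) / 2 - (x - p) ^ 3 / 3) +
      B * ((x - p) ^ 3 / 3)) / (q - p)
    let P1 : ℝ → ℝ := fun x => (x - p) * ((A * (q - x) + B * (x - p)) / (q - p))
    have hP : ∀ x, HasDerivAt P (P1 x) x := by
      intro x
      have hx : HasDerivAt (fun x : ℝ => x - p) 1 x := (hasDerivAt_id x).sub_const p
      refine HasDerivAt.congr_deriv (((((((hx.pow 2).mul_const (q - p)).div_const 2).sub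
        ((hx.pow 3).div_const 3)).const_mul A).add (((hx.pow 3).div_const 3).const_mul B)).div_const
          (q - p)) ?_
      simp only [P1]
      push_cast
      field_simp
      ring
    have hmono : MonotoneOn (fun x => η * (x - p) ^ 2 / 2 - σ * ((x - p) * e1 x - e x - P x))
        (Icc p q) := by
      refine monotoneOn_of_hasDerivWithinAt_nonneg (convex_Icc p q)
        (f' := fun x => η * (x - p) - σ * ((x - p) * e2 x - P1 x)) ?_ ?_ ?_
      · have : Continuous P := by fun_prop
        fun_prop
      · intro x hx
        rw [interior_Icc] at hx
        have h0 : HasDerivAt (fun x : ℝ => x - p) 1 x := (hasDerivAt_id x).sub_const p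
        have h5 := (((h0.pow 2).const_mul η).div_const 2).sub
          ((((h0.mul (hd1 x hx)).sub (hd x hx)).sub (hP x)).const_mul σ)
        exact (h5.congr_deriv (by push_cast; ring)).hasDerivWithinAt
      · intro x hx
        rw [interior_Icc] at hx
        have hxp : 0 < x - p := sub_pos.2 hx.1
        have h3 : (x - p) * e2 x - P1 x =
            (x - p) * (e2 x - (A * (q - x) + B * (x - p)) / (q - p)) := by
          simp only [P1]; ring
        have h4 : σ * (e2 x - (A * (q - x) + B * (x - p)) / (q - p)) ≤ η := by
          refine (le_abs_self _).trans ?_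
          rw [abs_mul, hσ, one_mul]
          exact h2 x hx
        rw [h3]
        nlinarith
    have h := hmono (left_mem_Icc.2 hpq.le) (right_mem_Icc.2 hpq.le) hpq.le
    have hPp : P p = 0 := by simp [P]
    have hPq : P q = (q - p) * ((q - p) * (B / 3 + A / 6)) := by
      simp only [P]; field_simp; ring
    simp only [hPp, hPq, hp, hq, sub_self] at h
    refine le_of_mul_le_mul_right ?_ hpos
    nlinarith
  rw [abs_le]
  constructor
  · have := key (-1) (by simp)
    linarith
  · have := key 1 (by simp)
    linarith

/-- The slope at the left end of an interval of a function vanishing at both ends. -/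
theorem abs_left_slope_add_le {p q η A B : ℝ} (hpq : p < q) {e e1 e2 : ℝ → ℝ}
    (he : ContinuousOn e (Icc p q)) (he1 : ContinuousOn e1 (Icc p q))
    (hd : ∀ x ∈ Ioo p q, HasDerivAt e (e1 x) x) (hd1 : ∀ x ∈ Ioo p q, HasDerivAt e1 (e2 x) x)
    (hp : e p = 0) (hq : e q = 0)
    (h2 : ∀ x ∈ Ioo p q, |e2 x - (A * (q - x) + B * (x - p)) / (q - p)| ≤ η) :
    |e1 p + (q - p) * (A / 3 + B / 6)| ≤ η * (q - p) / 2 := by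
  -- Reflection `x ↦ -x` exchanges the ends and turns this into the right-end estimate.
  have hmap : MapsTo (fun x : ℝ => -x) (Icc (-q) (-p)) (Icc p q) := fun x hx =>
    ⟨by linarith [hx.2], by linarith [hx.1]⟩
  have hmap' : ∀ x ∈ Ioo (-q) (-p), -x ∈ Ioo p q := fun x hx =>
    ⟨by linarith [hx.2], by linarith [hx.1]⟩
  have hcomp : ∀ (u : ℝ → ℝ) (u' x : ℝ), HasDerivAt u u' (-x) →
      HasDerivAt (fun y => u (-y)) (-u') x := by
    intro u u' x h
    exact (h.comp x (hasDerivAt_neg x)).congr_deriv (by ring)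
  have h := abs_right_slope_sub_le (p := -q) (q := -p) (η := η) (A := B) (B := A)
    (by linarith) (e := fun x => e (-x)) (e1 := fun x => -e1 (-x)) (e2 := fun x => e2 (-x))
    (he.comp continuousOn_neg hmap) (he1.comp continuousOn_neg hmap).neg
    (fun x hx => hcomp _ _ _ (hd _ (hmap' x hx)))
    (fun x hx => (hcomp _ _ _ (hd1 _ (hmap' x hx))).neg.congr_deriv (neg_neg _))
    (by simpa using hq) (by simpa using hp)
    (fun x hx => by
      convert h2 _ (hmap' x hx) using 3
      congr 1 <;> ring)
  rw [← abs_neg]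
  convert h using 2 <;> first | (simp only [neg_neg]; ring) | ring

/-! ### Nodes and subintervals of a partition. -/

namespace IntervalPartition

variable {a b : ℝ} (X : IntervalPartition a b)

theorem x_mem_Icc (j : Fin (X.N + 1)) : X.x j ∈ Icc a b :=
  ⟨X.first.symm.le.trans (X.strictMono.monotone (Fin.zero_le j)),
    (X.strictMono.monotone (Fin.le_last j)).trans X.last.le⟩

theorem x_lt_succ (i : Fin X.N) : X.x i.castSucc < X.x i.succ :=
  X.strictMono i.castSucc_lt_succ

theorem Icc_subset (i : Fin X.N) : Icc (X.x i.castSucc) (X.x i.succ) ⊆ Icc a b :=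
  Icc_subset_Icc (X.x_mem_Icc _).1 (X.x_mem_Icc _).2

theorem Ioo_subset (i : Fin X.N) :
    Ioo (X.x i.castSucc) (X.x i.succ) ⊆ Icc a b \ range X.x := by
  refine fun x hx => ⟨X.Icc_subset i (Ioo_subset_Icc_self hx), ?_⟩
  rintro ⟨k, rfl⟩
  have h1 := X.strictMono.lt_iff_lt.1 hx.1
  have h2 := X.strictMono.lt_iff_lt.1 hx.2
  rw [Fin.lt_def] at h1 h2
  simp at h1 h2
  omega

theorem exists_mem_Icc (hab : a < b) {x : ℝ} (hx : x ∈ Icc a b) :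
    ∃ i : Fin X.N, x ∈ Icc (X.x i.castSucc) (X.x i.succ) := by
  have key : ∀ j : Fin (X.N + 1), j ≠ 0 → x ≤ X.x j →
      ∃ i : Fin X.N, x ∈ Icc (X.x i.castSucc) (X.x i.succ) := by
    intro j
    induction j using Fin.induction with
    | zero => exact fun h => absurd rfl h
    | succ i ih =>
      intro _ hi
      by_cases h : x ≤ X.x i.castSucc
      · by_cases h0 : i.castSucc = 0
        · exact ⟨i, by rw [h0, X.first]; exact hx.1, hi⟩
        · exact ih h0 h
      · exact ⟨i, (not_le.1 h).le, hi⟩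
  refine key (Fin.last _) ?_ (hx.2.trans X.last.symm.le)
  intro h
  have := X.last
  rw [h, X.first] at this
  exact hab.ne this

theorem step_le_meshSize (i : Fin X.N) : X.x i.succ - X.x i.castSucc ≤ X.meshSize :=
  le_ciSup (f := X.step) (Set.finite_range _).bddAbove i

theorem meshSize_le (hab : a ≤ b) : X.meshSize ≤ b - a :=
  Real.iSup_le (fun _ => sub_le_sub (X.x_mem_Icc _).2 (X.x_mem_Icc _).1) (sub_nonneg.2 hab)

theorem meshSize_pos (hab : a < b) : 0 < X.meshSize := by
  obtain ⟨i, -⟩ := X.exists_mem_Icc hab (left_mem_Icc.2 hab.le)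
  exact (sub_pos.2 (X.x_lt_succ i)).trans_le (X.step_le_meshSize i)

end IntervalPartition

/-! ### The a priori estimate. -/

/-- Derivative bound for a function vanishing at both ends of an interval. -/
theorem abs_deriv_le_of_vanishing_ends {p q E : ℝ} (hpq : p < q) {e e1 e2 : ℝ → ℝ}
    (he : ContinuousOn e (Icc p q)) (hd : ∀ x ∈ Ioo p q, HasDerivAt e (e1 x) x)
    (hd1 : ∀ x ∈ Icc p q, HasDerivWithinAt e1 (e2 x) (Icc p q) x)
    (hp : e p = 0) (hq : e q = 0) (hE : ∀ x ∈ Icc p q, |e2 x| ≤ E)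
    {x : ℝ} (hx : x ∈ Icc p q) : |e1 x| ≤ E * (q - p) := by
  -- Rolle gives a zero of `e1`, from which `e1` grows at rate at most `E`.
  obtain ⟨c, hc, hc0⟩ := exists_hasDerivAt_eq_zero hpq he (hp.trans hq.symm) hd
  have h := Convex.norm_image_sub_le_of_norm_hasDerivWithin_le hd1 hE (convex_Icc p q)
    (Ioo_subset_Icc_self hc) hx
  rw [hc0, sub_zero] at h
  have hE0 : 0 ≤ E := (abs_nonneg _).trans (hE x hx)
  refine h.trans (mul_le_mul_of_nonneg_left ?_ hE0)
  rw [Real.norm_eq_abs, abs_le]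
  constructor <;> linarith [hx.1, hx.2, hc.1, hc.2]

set_option maxHeartbeats 1000000 in
/-- If `e` is of class `C²`, vanishes at the nodes, satisfies homogeneous end conditions, and
`(D² - α²)² e` is bounded by `K` between the nodes, then `e` is small with its derivatives. -/
theorem IntervalPartition.spline_error_estimate {a b : ℝ} (hab : a < b)
    (X : IntervalPartition a b) {α K : ℝ} (hα : 0 < α) (hα1 : α * (b - a) ≤ 1 / 16)
    {e e1 e2 r1 r2 : ℝ → ℝ}
    (he : ∀ x ∈ Icc a b, HasDerivWithinAt e (e1 x) (Icc a b) x)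
    (he1 : ∀ x ∈ Icc a b, HasDerivWithinAt e1 (e2 x) (Icc a b) x)
    (he2 : ContinuousOn e2 (Icc a b))
    (hr : ∀ x ∈ Icc a b \ range X.x, HasDerivAt (fun y => e2 y - α ^ 2 * e y) (r1 x) x)
    (hr1 : ∀ x ∈ Icc a b \ range X.x, HasDerivAt r1 (r2 x) x)
    (hr2 : ∀ x ∈ Icc a b \ range X.x, |r2 x - α ^ 2 * (e2 x - α ^ 2 * e x)| ≤ K)
    (h0 : ∀ j, e (X.x j) = 0)
    (hea : e1 a = 0 ∨ |e2 a| ≤ 2 * α * |e1 a|) (heb : e1 b = 0 ∨ |e2 b| ≤ 2 * α * |e1 b|)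
    {x : ℝ} (hx : x ∈ Icc a b) :
    |e x| ≤ K * X.meshSize ^ 4 ∧ |e1 x| ≤ K * X.meshSize ^ 3 ∧ |e2 x| ≤ K * X.meshSize ^ 2 := by
  set h := X.meshSize with hh
  have hpos : 0 < h := X.meshSize_pos hab
  have hαh : α * h ≤ 1 / 16 :=
    (mul_le_mul_of_nonneg_left (X.meshSize_le hab.le) hα.le).trans hα1
  have hαh0 : 0 < α * h := mul_pos hα hpos
  set A := α ^ 2 with hA
  have hA0 : 0 < A := by positivity
  have hAh : A * h ^ 2 ≤ 1 / 256 := by rw [hA, ← mul_pow]; nlinarith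
  set r : ℝ → ℝ := fun y => e2 y - A * e y with hrdef
  have hec : ContinuousOn e (Icc a b) := fun y hy => (he y hy).continuousWithinAt
  have he1c : ContinuousOn e1 (Icc a b) := fun y hy => (he1 y hy).continuousWithinAt
  have hrc : ContinuousOn r (Icc a b) := he2.sub (continuousOn_const.mul hec)
  have hne : (Icc a b).Nonempty := ⟨a, left_mem_Icc.2 hab.le⟩
  have hK0 : 0 ≤ K := by
    obtain ⟨i, -⟩ := X.exists_mem_Icc hab (left_mem_Icc.2 hab.le)
    have := X.x_lt_succ i
    exact (abs_nonneg _).trans (hr2 ((X.x i.castSucc + X.x i.succ) / 2)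
      (X.Ioo_subset i ⟨by linarith, by linarith⟩))
  -- the maxima of `|e''|`, of `|r|`, and of `|r|` over the nodes
  obtain ⟨z, hz, hzE⟩ := isCompact_Icc.exists_isMaxOn hne he2.abs
  obtain ⟨y, hy, hyR⟩ := isCompact_Icc.exists_isMaxOn hne hrc.abs
  obtain ⟨j, hj⟩ := Finite.exists_max (fun j => |r (X.x j)|)
  set E := |e2 z| with hEdef
  set R := |r y| with hRdef
  set W := |r (X.x j)| with hWdef
  have hE : ∀ x ∈ Icc a b, |e2 x| ≤ E := fun x hx => hzE hx
  have hR : ∀ x ∈ Icc a b, |r x| ≤ R := fun x hx => hyR hx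
  have hE0 : 0 ≤ E := abs_nonneg _
  have hR0 : 0 ≤ R := abs_nonneg _
  have hW0 : 0 ≤ W := abs_nonneg _
  -- local facts on a subinterval
  have hd : ∀ i, ∀ x ∈ Ioo (X.x (Fin.castSucc i)) (X.x i.succ), HasDerivAt e (e1 x) x ∧
      HasDerivAt e1 (e2 x) x := by
    intro i x hx
    have hx' := X.Icc_subset i (Ioo_subset_Icc_self hx)
    have hn : Icc a b ∈ nhds x := Filter.mem_of_superset (Ioo_mem_nhds hx.1 hx.2)
      (Ioo_subset_Icc_self.trans (X.Icc_subset i))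
    exact ⟨(he x hx').hasDerivAt hn, (he1 x hx').hasDerivAt hn⟩
  have hsq : ∀ i : Fin X.N, (X.x i.succ - X.x i.castSucc) ^ 2 ≤ h ^ 2 := fun i =>
    pow_le_pow_left₀ (sub_pos.2 (X.x_lt_succ i)).le (X.step_le_meshSize i) 2
  have hebd : ∀ x ∈ Icc a b, |e x| ≤ E * h ^ 2 / 8 := by
    intro x hx
    obtain ⟨i, hi⟩ := X.exists_mem_Icc hab hx
    have := abs_sub_chord_le (X.x_lt_succ i) (hec.mono (X.Icc_subset i))
      (fun x hx => (hd i x hx).1) (fun x hx => (hd i x hx).2)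
      (fun x hx => hE x (X.Icc_subset i (Ioo_subset_Icc_self hx))) hi
    simp only [h0, zero_mul, add_zero, zero_div, sub_zero] at this
    have := mul_le_mul_of_nonneg_left (hsq i) hE0
    linarith
  have he1bd : ∀ x ∈ Icc a b, |e1 x| ≤ E * h := by
    intro x hx
    obtain ⟨i, hi⟩ := X.exists_mem_Icc hab hx
    have := abs_deriv_le_of_vanishing_ends (X.x_lt_succ i) (hec.mono (X.Icc_subset i))
      (fun x hx => (hd i x hx).1)
      (fun x hx => (he1 x (X.Icc_subset i hx)).mono (X.Icc_subset i)) (h0 _) (h0 _)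
      (fun x hx => hE x (X.Icc_subset i hx)) hi
    exact this.trans (mul_le_mul_of_nonneg_left (X.step_le_meshSize i) hE0)
  have hr2bd : ∀ x ∈ Icc a b \ range X.x, |r2 x| ≤ A * R + K := by
    intro x hx
    have h1 := hr2 x hx
    have h2 := mul_le_mul_of_nonneg_left (hR x hx.1) hA0.le
    have h3 : |r2 x| ≤ |r2 x - A * r x| + |A * r x| := by
      simpa using abs_add_le (r2 x - A * r x) (A * r x)
    rw [abs_mul, abs_of_pos hA0] at h3
    change |r2 x - A * r x| ≤ K at h1
    linarith
  set δ := (A * R + K) * h ^ 2 / 8 with hδ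
  have hchord : ∀ i : Fin X.N, ∀ x ∈ Icc (X.x i.castSucc) (X.x i.succ),
      |r x - (r (X.x i.castSucc) * (X.x i.succ - x) + r (X.x i.succ) * (x - X.x i.castSucc)) /
        (X.x i.succ - X.x i.castSucc)| ≤ δ := by
    intro i x hx
    have := abs_sub_chord_le (X.x_lt_succ i) (hrc.mono (X.Icc_subset i))
      (fun x hx => hr x (X.Ioo_subset i hx)) (fun x hx => hr1 x (X.Ioo_subset i hx))
      (fun x hx => hr2bd x (X.Ioo_subset i hx)) hx
    have := mul_le_mul_of_nonneg_left (hsq i) (by positivity : 0 ≤ A * R + K)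
    linarith
  -- Distance of `e2 = r + A e` from the chord of `r`: the chord error of `r` plus `A` times the
  -- bound for `e`.
  set η := δ + A * (E * h ^ 2 / 8) with hη
  have he2lin : ∀ i : Fin X.N, ∀ x ∈ Ioo (X.x i.castSucc) (X.x i.succ),
      |e2 x - (r (X.x i.castSucc) * (X.x i.succ - x) + r (X.x i.succ) * (x - X.x i.castSucc)) /
        (X.x i.succ - X.x i.castSucc)| ≤ η := by
    intro i x hx
    have h1 := hchord i x (Ioo_subset_Icc_self hx)
    have h2 := mul_le_mul_of_nonneg_left
      (hebd x (X.Icc_subset i (Ioo_subset_Icc_self hx))) hA0.le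
    rw [← abs_of_pos hA0, ← abs_mul, abs_of_pos hA0] at h2
    have h3 : e2 x = r x + A * e x := by simp [hrdef]
    rw [h3]
    refine le_trans ?_ (add_le_add h1 h2)
    refine le_trans (le_of_eq ?_) (abs_add_le _ _)
    congr 1
    ring
  have hright : ∀ i : Fin X.N, |e1 (X.x i.succ) - (X.x i.succ - X.x i.castSucc) *
      (r (X.x i.succ) / 3 + r (X.x i.castSucc) / 6)| ≤
        η * (X.x i.succ - X.x i.castSucc) / 2 := fun i =>
    abs_right_slope_sub_le (X.x_lt_succ i) (hec.mono (X.Icc_subset i))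
      (he1c.mono (X.Icc_subset i)) (fun x hx => (hd i x hx).1) (fun x hx => (hd i x hx).2)
      (h0 _) (h0 _) (he2lin i)
  have hleft : ∀ i : Fin X.N, |e1 (X.x i.castSucc) + (X.x i.succ - X.x i.castSucc) *
      (r (X.x i.castSucc) / 3 + r (X.x i.succ) / 6)| ≤
        η * (X.x i.succ - X.x i.castSucc) / 2 := fun i =>
    abs_left_slope_add_le (X.x_lt_succ i) (hec.mono (X.Icc_subset i))
      (he1c.mono (X.Icc_subset i)) (fun x hx => (hd i x hx).1) (fun x hx => (hd i x hx).2)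
      (h0 _) (h0 _) (he2lin i)
  -- the three inequalities between `E`, `R`, `W`
  have hER : E ≤ R + A * (E * h ^ 2 / 8) := by
    have h2 := mul_le_mul_of_nonneg_left (hebd z hz) hA0.le
    rw [← abs_of_pos hA0, ← abs_mul, abs_of_pos hA0] at h2
    have h3 : e2 z = r z + A * e z := by simp [hrdef]
    calc E = |r z + A * e z| := by rw [hEdef, h3]
      _ ≤ _ := (abs_add_le _ _).trans (add_le_add (hR z hz) h2)
  have hRW : R ≤ W + δ := by
    obtain ⟨i, hi⟩ := X.exists_mem_Icc hab hy
    have h1 := hchord i y hi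
    have hp : 0 < X.x i.succ - X.x i.castSucc := sub_pos.2 (X.x_lt_succ i)
    set c := (r (X.x i.castSucc) * (X.x i.succ - y) + r (X.x i.succ) * (y - X.x i.castSucc)) /
        (X.x i.succ - X.x i.castSucc) with hc
    have hcW : |c| ≤ W := by
      rw [hc, abs_div, abs_of_pos hp, div_le_iff₀ hp]
      refine (abs_add_le _ _).trans ?_
      rw [abs_mul, abs_mul, abs_of_nonneg (sub_nonneg.2 hi.1), abs_of_nonneg (sub_nonneg.2 hi.2)]
      have h1 := mul_le_mul_of_nonneg_right (hj i.castSucc) (sub_nonneg.2 hi.2)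
      have h2 := mul_le_mul_of_nonneg_right (hj i.succ) (sub_nonneg.2 hi.1)
      linarith
    have : |r y| ≤ |c| + |r y - c| := by simpa using abs_add_le c (r y - c)
    linarith
  -- Only the row of the system at the node `j` with maximal `|r|` is used; the second alternative
  -- comes from the end condition `|e2| ≤ 2α |e1|`.
  have hWη : W ≤ 3 * η ∨ W ≤ 2 * α * (E * h) := by
    have hjabs : ∀ k, -W ≤ r (X.x k) ∧ r (X.x k) ≤ W := fun k => abs_le.1 (hj k)
    have hrob : ∀ c : ℝ, c ∈ Icc a b → e c = 0 → |e2 c| ≤ 2 * α * |e1 c| → |r c| = W →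
        W ≤ 2 * α * (E * h) := by
      intro c hc hec0 hc2 hcW
      have : r c = e2 c := by simp [hrdef, hec0]
      rw [← hcW, this]
      exact hc2.trans (mul_le_mul_of_nonneg_left (he1bd c hc) (by positivity))
    -- Here `s` is the value of `r` at the extremal node and `t` the total length of the adjacent
    -- steps. Diagonal dominance leaves `W / 3 - W / 6 ≤ η / 2`.
    have hfin : ∀ t s : ℝ, 0 < t → (s = W ∨ s = -W) → -(η / 2) * t ≤ s / 3 * t + W / 6 * t →
        s / 3 * t - W / 6 * t ≤ η / 2 * t → W ≤ 3 * η := by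
      intro t s ht hs h1 h2
      refine le_of_mul_le_mul_right ?_ ht
      rcases hs with rfl | rfl <;> nlinarith
    have hs : r (X.x j) = W ∨ r (X.x j) = -W := by
      rcases abs_choice (r (X.x j)) with hc | hc
      · exact Or.inl hc.symm
      · exact Or.inr (by rw [hWdef, hc, neg_neg])
    by_cases hj0 : j = 0
    · have hxa : X.x j = a := by rw [hj0, X.first]
      rcases hea with hea | hea
      · left
        obtain ⟨i, -⟩ := X.exists_mem_Icc hab (left_mem_Icc.2 hab.le)
        obtain ⟨i, hi⟩ : ∃ i : Fin X.N, i.castSucc = j := by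
          rw [Fin.exists_castSucc_eq, hj0]
          intro h; rw [Fin.ext_iff] at h; simp at h; exact absurd i.2 (by omega)
        have hl := abs_le.1 (hleft i)
        have hea' : e1 (X.x j) = 0 := by rw [hxa, hea]
        rw [hi, hea'] at hl
        have ht : 0 < X.x i.succ - X.x j := sub_pos.2 (hi ▸ X.x_lt_succ i)
        have hk := hjabs i.succ
        have m1 := mul_le_mul_of_nonneg_left hk.1 ht.le
        have m2 := mul_le_mul_of_nonneg_left hk.2 ht.le
        refine hfin _ _ ht hs ?_ ?_ <;> linarith
      · right
        exact hrob a (left_mem_Icc.2 hab.le) (hxa ▸ h0 j) hea (by rw [hWdef, hxa])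
    by_cases hjN : j = Fin.last _
    · have hxb : X.x j = b := by rw [hjN, X.last]
      rcases heb with heb | heb
      · left
        obtain ⟨i, hi⟩ := Fin.exists_succ_eq.2 hj0
        have hl := abs_le.1 (hright i)
        have heb' : e1 (X.x j) = 0 := by rw [hxb, heb]
        rw [hi, heb'] at hl
        have ht : 0 < X.x j - X.x i.castSucc := sub_pos.2 (hi ▸ X.x_lt_succ i)
        have hk := hjabs i.castSucc
        have m1 := mul_le_mul_of_nonneg_left hk.1 ht.le
        have m2 := mul_le_mul_of_nonneg_left hk.2 ht.le
        refine hfin _ _ ht hs ?_ ?_ <;> linarith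
      · right
        exact hrob b (right_mem_Icc.2 hab.le) (hxb ▸ h0 j) heb (by rw [hWdef, hxb])
    left
    -- At an interior node `e1` is the same from both sides; eliminating it between the two slope
    -- estimates gives the row.
    obtain ⟨i, hi⟩ := Fin.exists_succ_eq.2 hj0
    obtain ⟨i', hi'⟩ := Fin.exists_castSucc_eq.2 hjN
    have hl := abs_le.1 (hright i)
    have hl' := abs_le.1 (hleft i')
    rw [hi] at hl
    rw [hi'] at hl'
    have ht : 0 < X.x j - X.x i.castSucc := sub_pos.2 (hi ▸ X.x_lt_succ i)
    have ht' : 0 < X.x i'.succ - X.x j := sub_pos.2 (hi' ▸ X.x_lt_succ i')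
    have hk := hjabs i.castSucc
    have hk' := hjabs i'.succ
    have m1 := mul_le_mul_of_nonneg_left hk.1 ht.le
    have m2 := mul_le_mul_of_nonneg_left hk.2 ht.le
    have m3 := mul_le_mul_of_nonneg_left hk'.1 ht'.le
    have m4 := mul_le_mul_of_nonneg_left hk'.2 ht'.le
    refine hfin _ _ (add_pos ht ht') hs ?_ ?_ <;> linarith
  -- conclusion
  have hAE : A * (E * h ^ 2 / 8) ≤ E / 2048 := by nlinarith
  have hAR : A * R * h ^ 2 ≤ R / 256 := by nlinarith
  have hαE : 2 * α * (E * h) ≤ E / 8 := by nlinarith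
  have hKh : 0 ≤ K * h ^ 2 := by positivity
  have hδ' : δ ≤ (R / 256 + K * h ^ 2) / 8 := by rw [hδ]; linarith
  have hEK : E ≤ K * h ^ 2 := by rcases hWη with hW | hW <;> linarith
  have m0 := mul_le_mul_of_nonneg_right hEK hpos.le
  have m1 := mul_le_mul_of_nonneg_right hEK (sq_nonneg h)
  have m2 : 0 ≤ K * h ^ 4 := by positivity
  refine ⟨(hebd x hx).trans ?_, (he1bd x hx).trans ?_, (hE x hx).trans hEK⟩
  · linarith [(by ring : K * h ^ 2 * h ^ 2 = K * h ^ 4)]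
  · linarith [(by ring : K * h ^ 2 * h = K * h ^ 3)]

/-! ### The operator `(D² - α²)²` and one-sided derivatives. -/

theorem iteratedDeriv_two (u : ℝ → ℝ) : iteratedDeriv 2 u = deriv (deriv u) := by
  rw [iteratedDeriv_succ, iteratedDeriv_one]

theorem ContDiffAt.iteratedDeriv_two {m n : WithTop ℕ∞} {u : ℝ → ℝ} {x : ℝ}
    (hu : ContDiffAt ℝ n u x) (hmn : m + 1 + 1 ≤ n) : ContDiffAt ℝ m (iteratedDeriv 2 u) x := by
  rw [_root_.iteratedDeriv_two]
  exact (hu.derivWithin hmn).derivWithin le_rfl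

theorem ContDiffAt.hypOp {m n : WithTop ℕ∞} {u : ℝ → ℝ} {x : ℝ} (α : ℝ)
    (hu : ContDiffAt ℝ n u x) (hmn : m + 1 + 1 ≤ n) : ContDiffAt ℝ m (hypOp α u) x :=
  (hu.iteratedDeriv_two hmn).sub (contDiffAt_const.mul
    (hu.of_le ((le_self_add.trans le_self_add).trans hmn)))

/-- The operator `(D² - α²)²` in expanded form. -/
theorem hypOp_iterate_two {u : ℝ → ℝ} {x : ℝ} (α : ℝ) (hu : ContDiffAt ℝ 4 u x) :
    (hypOp α)^[2] u x =
      iteratedDeriv 4 u x - 2 * α ^ 2 * iteratedDeriv 2 u x + α ^ 4 * u x := by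
  have h2 : ContDiffAt ℝ (2 : ℕ) u x := hu.of_le (by norm_num)
  have h4 : iteratedDeriv 4 u = iteratedDeriv 2 (iteratedDeriv 2 u) := by
    simp [iteratedDeriv_eq_iterate]
  change iteratedDeriv 2 (fun y => iteratedDeriv 2 u y - α ^ 2 * u y) x -
    α ^ 2 * (iteratedDeriv 2 u x - α ^ 2 * u x) = _
  rw [iteratedDeriv_fun_sub (hu.iteratedDeriv_two (by norm_num))
    (contDiffAt_const.mul h2), iteratedDeriv_const_mul_field, h4]
  ring

theorem hypOp_iterate_two_sub {u v : ℝ → ℝ} {x : ℝ} (α : ℝ) (hu : ContDiffAt ℝ 4 u x)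
    (hv : ContDiffAt ℝ 4 v x) :
    (hypOp α)^[2] (u - v) x = (hypOp α)^[2] u x - (hypOp α)^[2] v x := by
  rw [hypOp_iterate_two α hu, hypOp_iterate_two α hv, hypOp_iterate_two (u := u - v) α (hu.sub hv),
    iteratedDeriv_sub (by exact_mod_cast hu) (by exact_mod_cast hv),
    iteratedDeriv_sub (hu.of_le (by norm_num)) (hv.of_le (by norm_num))]
  simp only [Pi.sub_apply]
  ring

/-- `(D² - α²)² f` is bounded for `f` of class `C⁴`. -/
theorem exists_bound_hypOp_iterate_two {a b : ℝ} (hab : a < b) (α : ℝ) {f : ℝ → ℝ}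
    (hf : ContDiffOn ℝ 4 f (Icc a b)) :
    ∃ K, ∀ x ∈ Ioo a b, |(hypOp α)^[2] f x| ≤ K := by
  have hud : UniqueDiffOn ℝ (Icc a b) := uniqueDiffOn_Icc hab
  have hc4 : ContinuousOn (iteratedDerivWithin 4 f (Icc a b)) (Icc a b) :=
    hf.continuousOn_iteratedDerivWithin (by norm_num) hud
  have hc2 : ContinuousOn (iteratedDerivWithin 2 f (Icc a b)) (Icc a b) :=
    hf.continuousOn_iteratedDerivWithin (by norm_num) hud
  have hc : ContinuousOn (fun x => iteratedDerivWithin 4 f (Icc a b) x -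
      2 * α ^ 2 * iteratedDerivWithin 2 f (Icc a b) x + α ^ 4 * f x) (Icc a b) :=
    (hc4.sub (continuousOn_const.mul hc2)).add (continuousOn_const.mul hf.continuousOn)
  obtain ⟨K, hK⟩ := isCompact_Icc.exists_bound_of_continuousOn hc
  refine ⟨K, fun x hx => ?_⟩
  have hx' := Ioo_subset_Icc_self hx
  have hfx : ContDiffAt ℝ 4 f x := hf.contDiffAt (Icc_mem_nhds hx.1 hx.2)
  have := hK x hx'
  rwa [iteratedDerivWithin_eq_iteratedDeriv hud (by exact_mod_cast hfx) hx',
    iteratedDerivWithin_eq_iteratedDeriv hud (hfx.of_le (by norm_num)) hx',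
    ← hypOp_iterate_two α hfx] at this

theorem hasDerivWithinAt_iteratedDerivWithin {a b : ℝ} (hab : a < b) {u : ℝ → ℝ}
    (hu : ContDiffOn ℝ 2 u (Icc a b)) {x : ℝ} (hx : x ∈ Icc a b) :
    HasDerivWithinAt u (iteratedDerivWithin 1 u (Icc a b) x) (Icc a b) x ∧
    HasDerivWithinAt (iteratedDerivWithin 1 u (Icc a b)) (iteratedDerivWithin 2 u (Icc a b) x)
      (Icc a b) x := by
  constructor
  · rw [iteratedDerivWithin_one]
    exact (hu.differentiableOn (by norm_num) x hx).hasDerivWithinAt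
  · rw [show (2 : ℕ) = 1 + 1 from rfl, iteratedDerivWithin_succ (n := 1)]
    exact (hu.differentiableOn_iteratedDerivWithin (by norm_num) (uniqueDiffOn_Icc hab)
      x hx).hasDerivWithinAt

theorem iteratedDerivWithin_eq_of_hasDerivWithinAt {a b : ℝ} (hab : a < b) {u u1 u2 : ℝ → ℝ}
    (h1 : ∀ x ∈ Icc a b, HasDerivWithinAt u (u1 x) (Icc a b) x)
    (h2 : ∀ x ∈ Icc a b, HasDerivWithinAt u1 (u2 x) (Icc a b) x) {x : ℝ} (hx : x ∈ Icc a b) :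
    iteratedDerivWithin 1 u (Icc a b) x = u1 x ∧ iteratedDerivWithin 2 u (Icc a b) x = u2 x := by
  have hud : UniqueDiffOn ℝ (Icc a b) := uniqueDiffOn_Icc hab
  have he : EqOn (iteratedDerivWithin 1 u (Icc a b)) u1 (Icc a b) := fun y hy => by
    rw [iteratedDerivWithin_one]
    exact (h1 y hy).derivWithin (hud y hy)
  refine ⟨he hx, ?_⟩
  rw [show (2 : ℕ) = 1 + 1 from rfl, iteratedDerivWithin_succ (n := 1), derivWithin_congr he (he hx)]
  exact (h2 x hx).derivWithin (hud x hx)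

/-! ### Weights and the estimate for weighted functions. -/

/-- A smooth positive weight with logarithmic derivative bounded by `α`. -/
structure AdmissibleWeight (α : ℝ) (w : ℝ → ℝ) : Prop where
  contDiff : ContDiff ℝ 4 w
  pos : ∀ x, 0 < w x
  abs_deriv_le : ∀ x, |deriv w x| ≤ α * w x

namespace AdmissibleWeight

variable {α : ℝ} {w : ℝ → ℝ}

theorem hasDerivAt (hw : AdmissibleWeight α w) (x : ℝ) : HasDerivAt w (deriv w x) x :=
  (hw.contDiff.differentiable (by norm_num) x).hasDerivAt

theorem contDiffAt_deriv (hw : AdmissibleWeight α w) (x : ℝ) : ContDiffAt ℝ 3 (deriv w) x :=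
  hw.contDiff.contDiffAt.derivWithin (by norm_num)

theorem hasDerivAt_deriv (hw : AdmissibleWeight α w) (x : ℝ) :
    HasDerivAt (deriv w) (deriv (deriv w) x) x :=
  ((hw.contDiffAt_deriv x).differentiableAt (by norm_num)).hasDerivAt

theorem continuous_deriv_deriv (hw : AdmissibleWeight α w) : Continuous (deriv (deriv w)) :=
  continuous_iff_continuousAt.2 fun x =>
    ((hw.contDiffAt_deriv x).derivWithin (m := 2) (by norm_num)).continuousAt

theorem contDiffOn_mul (hw : AdmissibleWeight α w) {s : Set ℝ} {u : ℝ → ℝ}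
    (hu : ContDiffOn ℝ 2 u s) : ContDiffOn ℝ 2 (fun x => w x * u x) s :=
  (hw.contDiff.of_le (by norm_num)).contDiffOn.mul hu

theorem contDiffOn_div (hw : AdmissibleWeight α w) {s : Set ℝ} {f : ℝ → ℝ}
    (hf : ContDiffOn ℝ 4 f s) : ContDiffOn ℝ 4 (f / w) s :=
  hf.div hw.contDiff.contDiffOn fun x _ => (hw.pos x).ne'

/-- Product rule for the weighted function. -/
theorem iteratedDerivWithin_mul (hw : AdmissibleWeight α w) {a b : ℝ} (hab : a < b) {u : ℝ → ℝ}
    (hu : ContDiffOn ℝ 2 u (Icc a b)) {x : ℝ} (hx : x ∈ Icc a b) :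
    iteratedDerivWithin 1 (fun x => w x * u x) (Icc a b) x =
      deriv w x * u x + w x * iteratedDerivWithin 1 u (Icc a b) x ∧
    iteratedDerivWithin 2 (fun x => w x * u x) (Icc a b) x =
      deriv (deriv w) x * u x + 2 * (deriv w x * iteratedDerivWithin 1 u (Icc a b) x) +
        w x * iteratedDerivWithin 2 u (Icc a b) x := by
  have hu' := fun y (hy : y ∈ Icc a b) => hasDerivWithinAt_iteratedDerivWithin hab hu hy
  refine iteratedDerivWithin_eq_of_hasDerivWithinAt hab
    (u1 := fun y => deriv w y * u y + w y * iteratedDerivWithin 1 u (Icc a b) y)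
    (u2 := fun y => deriv (deriv w) y * u y +
      2 * (deriv w y * iteratedDerivWithin 1 u (Icc a b) y) +
        w y * iteratedDerivWithin 2 u (Icc a b) y) ?_ ?_ hx
  · exact fun y hy => (hw.hasDerivAt y).hasDerivWithinAt.mul (hu' y hy).1
  · exact fun y hy => (((hw.hasDerivAt_deriv y).hasDerivWithinAt.mul (hu' y hy).1).add
      ((hw.hasDerivAt y).hasDerivWithinAt.mul (hu' y hy).2)).congr_deriv (by ring)

/-- At an end where `u = 0`, the product rule reduces to `(w u)' = w u'` and `(w u)'' = 2 w' u' + w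
u''`. Type I thus gives `u' = 0`, while types II and III give a Robin condition whose coefficient is
controlled by `|w'| ≤ α w`. -/
theorem endCondition_zero (hw : AdmissibleWeight α w) {a b : ℝ} (hab : a < b) {u : ℝ → ℝ}
    (hu : ContDiffOn ℝ 2 u (Icc a b)) (hua : u a = 0) (hub : u b = 0) {e : EndType}
    (he : EndCondition a b 0 (fun x => w x * u x) e) :
    ∀ c, c = a ∨ c = b → iteratedDerivWithin 1 u (Icc a b) c = 0 ∨
      |iteratedDerivWithin 2 u (Icc a b) c| ≤ 2 * α * |iteratedDerivWithin 1 u (Icc a b) c| := by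
  intro c hc
  have hcm : c ∈ Icc a b := by
    rcases hc with rfl | rfl
    exacts [left_mem_Icc.2 hab.le, right_mem_Icc.2 hab.le]
  have huc : u c = 0 := by rcases hc with rfl | rfl <;> assumption
  obtain ⟨m1, m2⟩ := hw.iteratedDerivWithin_mul hab hu hcm
  rw [huc, mul_zero, zero_add] at m1
  rw [huc, mul_zero, zero_add] at m2
  have hwc := hw.pos c
  have robin : iteratedDerivWithin 2 (fun x => w x * u x) (Icc a b) c = 0 →
      |iteratedDerivWithin 2 u (Icc a b) c| ≤
        2 * α * |iteratedDerivWithin 1 u (Icc a b) c| := by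
    intro h
    rw [m2] at h
    have h1 : w c * iteratedDerivWithin 2 u (Icc a b) c =
        -(2 * (deriv w c * iteratedDerivWithin 1 u (Icc a b) c)) := by linarith
    have h2 := congrArg abs h1
    rw [abs_neg, abs_mul, abs_mul, abs_mul, abs_of_pos hwc, abs_two] at h2
    have h3 := mul_le_mul_of_nonneg_right (hw.abs_deriv_le c)
      (abs_nonneg (iteratedDerivWithin 1 u (Icc a b) c))
    refine le_of_mul_le_mul_left ?_ hwc
    rw [h2]
    linarith
  have hz2 : ∀ c, iteratedDerivWithin 2 (0 : ℝ → ℝ) (Icc a b) c = 0 := by simp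
  have hz1 : ∀ c, iteratedDerivWithin 1 (0 : ℝ → ℝ) (Icc a b) c = 0 := by simp
  cases e with
  | I =>
    left
    have : iteratedDerivWithin 1 (fun x => w x * u x) (Icc a b) c = 0 := by
      rcases hc with rfl | rfl
      exacts [he.1.trans (hz1 _), he.2.trans (hz1 _)]
    rw [m1] at this
    exact (mul_eq_zero.1 this).resolve_left hwc.ne'
  | II =>
    refine Or.inr (robin ?_)
    rcases hc with rfl | rfl
    exacts [he.1, he.2]
  | III =>
    refine Or.inr (robin ?_)
    rcases hc with rfl | rfl
    exacts [he.1.trans (hz2 _), he.2.trans (hz2 _)]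

end AdmissibleWeight

namespace IntervalPartition

variable {a b : ℝ} (X : IntervalPartition a b)

theorem compl_nodes_mem_nhds {x : ℝ} (hx : x ∈ Icc a b \ range X.x) :
    x ∈ Ioo a b ∧ Icc a b \ range X.x ∈ nhds x := by
  have hxo : x ∈ Ioo a b := by
    refine ⟨lt_of_le_of_ne hx.1.1 ?_, lt_of_le_of_ne hx.1.2 ?_⟩
    · rintro rfl; exact hx.2 ⟨0, X.first⟩
    · rintro rfl; exact hx.2 ⟨Fin.last _, X.last⟩
  refine ⟨hxo, ?_⟩
  rw [sdiff_eq]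
  exact Filter.inter_mem (Icc_mem_nhds hxo.1 hxo.2)
    ((finite_range X.x).isClosed.isOpen_compl.mem_nhds hx.2)

/-- The error estimate with `Icc`-derivatives. -/
theorem iteratedDerivWithin_error_estimate (hab : a < b) {α K : ℝ} (hα : 0 < α)
    (hα1 : α * (b - a) ≤ 1 / 16) {u : ℝ → ℝ} (hu : ContDiffOn ℝ 2 u (Icc a b))
    (hu4 : ContDiffOn ℝ 4 u (Icc a b \ range X.x))
    (hK : ∀ x ∈ Icc a b \ range X.x, |(hypOp α)^[2] u x| ≤ K)
    (h0 : ∀ j, u (X.x j) = 0)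
    (hend : ∀ c, c = a ∨ c = b → iteratedDerivWithin 1 u (Icc a b) c = 0 ∨
      |iteratedDerivWithin 2 u (Icc a b) c| ≤ 2 * α * |iteratedDerivWithin 1 u (Icc a b) c|)
    {x : ℝ} (hx : x ∈ Icc a b) :
    |u x| ≤ K * X.meshSize ^ 4 ∧
    |iteratedDerivWithin 1 u (Icc a b) x| ≤ K * X.meshSize ^ 3 ∧
    |iteratedDerivWithin 2 u (Icc a b) x| ≤ K * X.meshSize ^ 2 := by
  have hu' := fun y (hy : y ∈ Icc a b) => hasDerivWithinAt_iteratedDerivWithin hab hu hy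
  have hat : ∀ y ∈ Icc a b \ range X.x, ContDiffAt ℝ 4 u y := fun y hy =>
    hu4.contDiffAt (X.compl_nodes_mem_nhds hy).2
  have hhyp : ∀ y ∈ Icc a b \ range X.x, ContDiffAt ℝ 2 (hypOp α u) y := fun y hy =>
    (hat y hy).hypOp α (by norm_num)
  -- `hypOp` uses two-sided derivatives, which agree with those within `Icc a b` at every point that
  -- is not a node.
  have heq : ∀ y ∈ Icc a b \ range X.x,
      hypOp α u y = iteratedDerivWithin 2 u (Icc a b) y - α ^ 2 * u y := by
    intro y hy
    rw [iteratedDerivWithin_eq_iteratedDeriv (uniqueDiffOn_Icc hab)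
      ((hat y hy).of_le (by norm_num)) hy.1]
    rfl
  refine X.spline_error_estimate hab hα hα1 (r1 := deriv (hypOp α u))
    (r2 := deriv (deriv (hypOp α u))) (fun y hy => (hu' y hy).1) (fun y hy => (hu' y hy).2)
    (hu.continuousOn_iteratedDerivWithin le_rfl (uniqueDiffOn_Icc hab)) ?_ ?_ ?_ h0
    (hend a (Or.inl rfl)) (hend b (Or.inr rfl)) hx
  · intro y hy
    refine ((hhyp y hy).differentiableAt (by norm_num)).hasDerivAt.congr_of_eventuallyEq ?_
    filter_upwards [(X.compl_nodes_mem_nhds hy).2] with z hz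
    exact (heq z hz).symm
  · intro y hy
    exact (((hhyp y hy).derivWithin (m := 1) (by norm_num)).differentiableAt
      (by norm_num)).hasDerivAt
  · intro y hy
    rw [← heq y hy, ← iteratedDeriv_two]
    exact hK y hy

end IntervalPartition

/-- The error estimate for a weighted function. -/
theorem AdmissibleWeight.exists_error_estimate {α : ℝ} {w : ℝ → ℝ} (hw : AdmissibleWeight α w)
    {a b : ℝ} (hab : a < b) (hα : 0 < α) (hα1 : α * (b - a) ≤ 1 / 16) :
    ∃ B : ℝ, 0 < B ∧ ∀ (X : IntervalPartition a b) (e : EndType) (K : ℝ) (u : ℝ → ℝ),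
      ContDiffOn ℝ 2 u (Icc a b) → ContDiffOn ℝ 4 u (Icc a b \ range X.x) →
      (∀ x ∈ Icc a b \ range X.x, |(hypOp α)^[2] u x| ≤ K) → (∀ j, u (X.x j) = 0) →
      EndCondition a b 0 (fun x => w x * u x) e →
      ∀ i ≤ 2, ∀ x ∈ Icc a b, |iteratedDerivWithin i (fun x => w x * u x) (Icc a b) x| ≤
        B * K * X.meshSize ^ (4 - i) := by
  obtain ⟨M0, hM0⟩ := isCompact_Icc.exists_bound_of_continuousOn
    (hw.contDiff.continuous.continuousOn (s := Icc a b))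
  obtain ⟨M1, hM1⟩ := isCompact_Icc.exists_bound_of_continuousOn
    ((continuous_iff_continuousAt.2 fun x => (hw.contDiffAt_deriv x).continuousAt).continuousOn
      (s := Icc a b))
  obtain ⟨M2, hM2⟩ := isCompact_Icc.exists_bound_of_continuousOn
    (hw.continuous_deriv_deriv.continuousOn (s := Icc a b))
  set M := max 1 (max M0 (max M1 M2)) with hM
  have hMpos : 0 < M := lt_of_lt_of_le one_pos (le_max_left _ _)
  have hH : 0 < b - a := sub_pos.2 hab
  -- `M` bounds `w`, `w'`, `w''`. Surplus powers of `h` are replaced by powers of `b - a`; for `i =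
  -- 2` the Leibniz coefficients 1, 2, 1 then sum to this square.
  refine ⟨M * (b - a + 1) ^ 2, by positivity, ?_⟩
  intro X e K u hu hu4 hK h0 hend i hi x hx
  have hua : u a = 0 := X.first ▸ h0 0
  have hub : u b = 0 := by
    have := h0 (Fin.last _)
    rwa [X.last] at this
  obtain ⟨e0, e1, e2⟩ := X.iteratedDerivWithin_error_estimate hab hα hα1 hu hu4 hK h0
    (hw.endCondition_zero hab hu hua hub hend) hx
  obtain ⟨m1, m2⟩ := hw.iteratedDerivWithin_mul hab hu hx
  have hK0 : 0 ≤ K := by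
    obtain ⟨i, -⟩ := X.exists_mem_Icc hab hx
    have := X.x_lt_succ i
    exact (abs_nonneg _).trans (hK ((X.x i.castSucc + X.x i.succ) / 2)
      (X.Ioo_subset i ⟨by linarith, by linarith⟩))
  have hh0 : 0 ≤ X.meshSize := (X.meshSize_pos hab).le
  have hh : X.meshSize ≤ b - a := X.meshSize_le hab.le
  set h := X.meshSize
  set H := b - a
  have w0 : |w x| ≤ M := (hM0 x hx).trans ((le_max_left _ _).trans (le_max_right _ _))
  have w1 : |deriv w x| ≤ M := (hM1 x hx).trans
    ((le_max_left _ _).trans ((le_max_right _ _).trans (le_max_right _ _)))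
  have w2 : |deriv (deriv w) x| ≤ M := (hM2 x hx).trans
    ((le_max_right _ _).trans ((le_max_right _ _).trans (le_max_right _ _)))
  have mul_bd : ∀ {p q P Q : ℝ}, |p| ≤ P → |q| ≤ Q → |p * q| ≤ P * Q := fun hp hq => by
    rw [abs_mul]
    exact mul_le_mul hp hq (abs_nonneg _) ((abs_nonneg _).trans hp)
  have hMK : 0 ≤ M * K := mul_nonneg hMpos.le hK0
  interval_cases i
  · rw [iteratedDerivWithin_zero]
    refine (mul_bd w0 e0).trans ?_
    have : 0 ≤ M * K * h ^ 4 * (H ^ 2 + 2 * H) := by positivity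
    linarith [(by ring : M * (H + 1) ^ 2 * K * h ^ (4 - 0) = M * (K * h ^ 4) +
      M * K * h ^ 4 * (H ^ 2 + 2 * H))]
  · rw [m1]
    refine (abs_add_le _ _).trans ((add_le_add (mul_bd w1 e0) (mul_bd w0 e1)).trans ?_)
    have t1 : 0 ≤ M * K * h ^ 3 * (H - h) :=
      mul_nonneg (by positivity) (sub_nonneg.2 hh)
    have t2 : 0 ≤ M * K * h ^ 3 * (H ^ 2 + H) := by positivity
    change _ ≤ M * (H + 1) ^ 2 * K * h ^ 3
    linarith [(by ring : M * (H + 1) ^ 2 * K * h ^ 3 = M * (K * h ^ 4) + M * (K * h ^ 3) +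
      M * K * h ^ 3 * (H - h) + M * K * h ^ 3 * (H ^ 2 + H))]
  · rw [m2]
    refine (abs_add_le _ _).trans ((add_le_add (abs_add_le _ _) (mul_bd w0 e2)).trans ?_)
    have t0 : |2 * (deriv w x * iteratedDerivWithin 1 u (Icc a b) x)| ≤ 2 * (M * (K * h ^ 3)) :=
      mul_bd (by norm_num) (mul_bd w1 e1)
    have t1 : 0 ≤ M * K * h ^ 2 * (H - h) :=
      mul_nonneg (by positivity) (sub_nonneg.2 hh)
    have t2 : 0 ≤ M * K * h ^ 2 * ((H - h) * (H + h)) :=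
      mul_nonneg (by positivity) (mul_nonneg (sub_nonneg.2 hh) (by positivity))
    have t3 := mul_bd w2 e0
    change _ ≤ M * (H + 1) ^ 2 * K * h ^ 2
    linarith [(by ring : M * (H + 1) ^ 2 * K * h ^ 2 = M * (K * h ^ 4) +
      2 * (M * (K * h ^ 3)) + M * (K * h ^ 2) +
      2 * (M * K * h ^ 2 * (H - h)) + M * K * h ^ 2 * ((H - h) * (H + h)))]

/-! ### Solutions of `(D² - α²)² u = 0` and the truncated kernel basis. -/

theorem contDiff_succ_of_hasDerivAt {u u1 : ℝ → ℝ} {n : ℕ} (h : ∀ x, HasDerivAt u (u1 x) x)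
    (h1 : ContDiff ℝ n u1) : ContDiff ℝ ((n + 1 : ℕ) : WithTop ℕ∞) u := by
  rw [Nat.cast_add, Nat.cast_one, contDiff_succ_iff_deriv]
  refine ⟨fun x => (h x).differentiableAt, fun hn => ?_, ?_⟩
  · exact absurd hn (by exact_mod_cast WithTop.natCast_ne_top (α := ℕ∞) n)
  · rwa [show deriv u = u1 from funext fun x => (h x).deriv]

/-- Global solutions of `(D² - α²)² u = 0`. -/
noncomputable def IsBihyperbolic (α : ℝ) (u : ℝ → ℝ) : Prop :=
  ∃ u1 u2 u3 : ℝ → ℝ, (∀ x, HasDerivAt u (u1 x) x) ∧ (∀ x, HasDerivAt u1 (u2 x) x) ∧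
    (∀ x, HasDerivAt u2 (u3 x) x) ∧
    ∀ x, HasDerivAt u3 (2 * α ^ 2 * u2 x - α ^ 4 * u x) x

namespace IsBihyperbolic

variable {α : ℝ} {u v : ℝ → ℝ}

theorem add (hu : IsBihyperbolic α u) (hv : IsBihyperbolic α v) :
    IsBihyperbolic α (fun x => u x + v x) := by
  obtain ⟨u1, u2, u3, h1, h2, h3, h4⟩ := hu
  obtain ⟨v1, v2, v3, k1, k2, k3, k4⟩ := hv
  exact ⟨fun x => u1 x + v1 x, fun x => u2 x + v2 x, fun x => u3 x + v3 x,
    fun x => (h1 x).add (k1 x), fun x => (h2 x).add (k2 x), fun x => (h3 x).add (k3 x),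
    fun x => ((h4 x).add (k4 x)).congr_deriv (by ring)⟩

theorem const_mul (c : ℝ) (hu : IsBihyperbolic α u) : IsBihyperbolic α (fun x => c * u x) := by
  obtain ⟨u1, u2, u3, h1, h2, h3, h4⟩ := hu
  exact ⟨fun x => c * u1 x, fun x => c * u2 x, fun x => c * u3 x,
    fun x => (h1 x).const_mul c, fun x => (h2 x).const_mul c, fun x => (h3 x).const_mul c,
    fun x => ((h4 x).const_mul c).congr_deriv (by ring)⟩

theorem comp_sub_const (c : ℝ) (hu : IsBihyperbolic α u) :
    IsBihyperbolic α (fun x => u (x - c)) := by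
  obtain ⟨u1, u2, u3, h1, h2, h3, h4⟩ := hu
  exact ⟨fun x => u1 (x - c), fun x => u2 (x - c), fun x => u3 (x - c),
    fun x => (h1 _).comp_sub_const x c, fun x => (h2 _).comp_sub_const x c,
    fun x => (h3 _).comp_sub_const x c, fun x => (h4 _).comp_sub_const x c⟩

theorem zero : IsBihyperbolic α (fun _ => 0) :=
  ⟨fun _ => 0, fun _ => 0, fun _ => 0, fun x => hasDerivAt_const x 0,
    fun x => hasDerivAt_const x 0, fun x => hasDerivAt_const x 0,
    fun x => (hasDerivAt_const x 0).congr_deriv (by ring)⟩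

theorem sum {ι : Type*} (s : Finset ι) {u : ι → ℝ → ℝ}
    (hu : ∀ i ∈ s, IsBihyperbolic α (u i)) : IsBihyperbolic α (fun x => ∑ i ∈ s, u i x) := by
  classical
  induction s using Finset.induction_on with
  | empty => simpa using zero
  | insert i s hi ih =>
    simp only [Finset.sum_insert hi]
    exact (hu i (Finset.mem_insert_self i s)).add
      (ih fun j hj => hu j (Finset.mem_insert_of_mem hj))

theorem contDiff (hu : IsBihyperbolic α u) : ContDiff ℝ 4 u := by
  obtain ⟨u1, u2, u3, h1, h2, h3, h4⟩ := hu
  have c0 : Continuous u := continuous_iff_continuousAt.2 fun x => (h1 x).continuousAt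
  have c2 : Continuous u2 := continuous_iff_continuousAt.2 fun x => (h3 x).continuousAt
  have c4 : ContDiff ℝ (0 : ℕ) (fun x => 2 * α ^ 2 * u2 x - α ^ 4 * u x) := by
    rw [Nat.cast_zero, contDiff_zero]; fun_prop
  exact contDiff_succ_of_hasDerivAt h1 (contDiff_succ_of_hasDerivAt h2
    (contDiff_succ_of_hasDerivAt h3 (contDiff_succ_of_hasDerivAt h4 c4)))

theorem hypOp_iterate_two_eq_zero (hu : IsBihyperbolic α u) (x : ℝ) :
    (hypOp α)^[2] u x = 0 := by
  rw [hypOp_iterate_two α hu.contDiff.contDiffAt]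
  obtain ⟨u1, u2, u3, h1, h2, h3, h4⟩ := hu
  have e1 : deriv u = u1 := funext fun x => (h1 x).deriv
  have e2 : deriv u1 = u2 := funext fun x => (h2 x).deriv
  have e3 : deriv u2 = u3 := funext fun x => (h3 x).deriv
  simp only [iteratedDeriv_eq_iterate, Function.iterate_succ, Function.iterate_zero,
    Function.comp, id, e1, e2, e3, (h4 x).deriv]
  ring

end IsBihyperbolic

/-- The truncation at `c` of a function with a critical point at `0`. -/
theorem HasDerivAt.truncate {k k1 : ℝ → ℝ} (hk : ∀ y, HasDerivAt k (k1 y) y) (h0 : k1 0 = 0)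
    (c x : ℝ) : HasDerivAt (fun x => k (max (x - c) 0)) (k1 (max (x - c) 0)) x := by
  rcases lt_trichotomy x c with hx | rfl | hx
  · rw [max_eq_right (by linarith), h0]
    refine (hasDerivAt_const x (k 0)).congr_of_eventuallyEq ?_
    filter_upwards [Iio_mem_nhds hx] with y hy
    rw [max_eq_right (by linarith [mem_Iio.1 hy])]
  -- At the truncation point the left side is constant, so `k1 0 = 0` makes the one-sided
  -- derivatives agree.
  · have hl : HasDerivWithinAt (fun y => k (max (y - x) 0)) (k1 0) (Iic x) x := by
      rw [h0]
      refine (hasDerivWithinAt_const x _ (k 0)).congr (fun y hy => ?_) (by simp)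
      rw [max_eq_right (by linarith [mem_Iic.1 hy])]
    have hr : HasDerivWithinAt (fun y => k (max (y - x) 0)) (k1 0) (Ici x) x := by
      have h1 : HasDerivAt (fun y => k (y - x)) (k1 0) x :=
        HasDerivAt.comp_sub_const x x (by simpa using hk 0)
      refine h1.hasDerivWithinAt.congr (fun y hy => ?_) (by simp)
      rw [max_eq_left (by linarith [mem_Ici.1 hy])]
    have := hl.union hr
    rw [Iic_union_Ici, hasDerivWithinAt_univ] at this
    simpa using this
  · rw [max_eq_left (by linarith)]
    refine ((hk (x - c)).comp_sub_const x c).congr_of_eventuallyEq ?_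
    filter_upwards [Ioi_mem_nhds hx] with y hy
    rw [max_eq_left (by linarith [mem_Ioi.1 hy])]

theorem hasDerivAt_cosh_mul (α y : ℝ) :
    HasDerivAt (fun y => Real.cosh (α * y)) (α * Real.sinh (α * y)) y :=
  (((hasDerivAt_id y).const_mul α).cosh).congr_deriv (by simp; ring)

theorem hasDerivAt_sinh_mul (α y : ℝ) :
    HasDerivAt (fun y => Real.sinh (α * y)) (α * Real.cosh (α * y)) y :=
  (((hasDerivAt_id y).const_mul α).sinh).congr_deriv (by simp; ring)

/-- This four-parameter family is closed under differentiation, so all higher derivatives come from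
the same formula with new coefficients. -/
theorem hasDerivAt_poly_mul_hyp (α p q r s y : ℝ) :
    HasDerivAt (fun y => (p + q * y) * Real.cosh (α * y) + (r + s * y) * Real.sinh (α * y))
      ((q + α * r + α * s * y) * Real.cosh (α * y) +
        (s + α * p + α * q * y) * Real.sinh (α * y)) y := by
  have hl : ∀ p q : ℝ, HasDerivAt (fun y => p + q * y) q y := fun p q =>
    (((hasDerivAt_id y).const_mul q).const_add p).congr_deriv (by simp)
  exact (((hl p q).mul (hasDerivAt_cosh_mul α y)).add
    ((hl r s).mul (hasDerivAt_sinh_mul α y))).congr_deriv (by ring)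

theorem isBihyperbolic_poly_mul_hyp (α p q r s : ℝ) : IsBihyperbolic α
    (fun y => (p + q * y) * Real.cosh (α * y) + (r + s * y) * Real.sinh (α * y)) :=
  ⟨_, _, _, fun y => hasDerivAt_poly_mul_hyp α p q r s y,
    fun y => hasDerivAt_poly_mul_hyp α _ _ _ _ y, fun y => hasDerivAt_poly_mul_hyp α _ _ _ _ y,
    fun y => (hasDerivAt_poly_mul_hyp α _ _ _ _ y).congr_deriv (by ring)⟩

/-- The solution of `(D² - α²)² k = 0` with a triple zero at `0`. -/
noncomputable def hypKernel (α y : ℝ) : ℝ := α * y * Real.cosh (α * y) - Real.sinh (α * y)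

theorem isBihyperbolic_hypKernel (α : ℝ) : IsBihyperbolic α (hypKernel α) := by
  convert isBihyperbolic_poly_mul_hyp α 0 α (-1) 0 using 1
  funext y
  simp only [hypKernel]
  ring

theorem hasDerivAt_hypKernel (α y : ℝ) :
    HasDerivAt (hypKernel α) (α ^ 2 * y * Real.sinh (α * y)) y := by
  have h := hasDerivAt_poly_mul_hyp α 0 α (-1) 0 y
  refine (h.congr_of_eventuallyEq (.of_forall fun z => ?_)).congr_deriv (by ring)
  simp only [hypKernel]
  ring

theorem hasDerivAt_deriv_hypKernel (α y : ℝ) :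
    HasDerivAt (fun y => α ^ 2 * y * Real.sinh (α * y))
      (α ^ 2 * (Real.sinh (α * y) + α * y * Real.cosh (α * y))) y := by
  have h := hasDerivAt_poly_mul_hyp α 0 0 0 (α ^ 2) y
  refine (h.congr_of_eventuallyEq (.of_forall fun z => ?_)).congr_deriv (by ring)
  simp only
  ring

@[simp] theorem hypKernel_zero (α : ℝ) : hypKernel α 0 = 0 := by simp [hypKernel]

theorem hypKernel_pos {α y : ℝ} (hα : 0 < α) (hy : 0 < y) : 0 < hypKernel α y := by
  have h : StrictMonoOn (hypKernel α) (Ici 0) := by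
    refine strictMonoOn_of_deriv_pos (convex_Ici 0)
      (fun x _ => (hasDerivAt_hypKernel α x).continuousAt.continuousWithinAt) fun x hx => ?_
    rw [interior_Ici] at hx
    have hx : 0 < x := hx
    rw [(hasDerivAt_hypKernel α x).deriv]
    have : 0 < Real.sinh (α * x) := Real.sinh_pos_iff.2 (by positivity)
    positivity
  simpa using h (mem_Ici.2 le_rfl) (mem_Ici.2 hy.le) hy

namespace IntervalPartition

variable {a b : ℝ} (X : IntervalPartition a b)

/-- The spline with given coefficients in the truncated kernel basis. -/
noncomputable def hypSpline (α : ℝ) (v : (Fin 3 → ℝ) × (Fin X.N → ℝ)) (x : ℝ) : ℝ :=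
  -- The zero coefficient drops the fourth solution `y cosh (α y)`: the kernel at the first node `a`
  -- supplies it, as it is not cut off on `[a, b]`. This leaves `N + 3` parameters.
  ((v.1 0 + 0 * (x - a)) * Real.cosh (α * (x - a)) +
    (v.1 1 + v.1 2 * (x - a)) * Real.sinh (α * (x - a))) +
    ∑ j : Fin X.N, v.2 j * hypKernel α (max (x - X.x j.castSucc) 0)

theorem hypSpline_add (α : ℝ) (v v' : (Fin 3 → ℝ) × (Fin X.N → ℝ)) (x : ℝ) :
    X.hypSpline α (v + v') x = X.hypSpline α v x + X.hypSpline α v' x := by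
  simp only [hypSpline, Prod.fst_add, Prod.snd_add, Pi.add_apply, add_mul,
    Finset.sum_add_distrib]
  ring

theorem hypSpline_smul (α c : ℝ) (v : (Fin 3 → ℝ) × (Fin X.N → ℝ)) (x : ℝ) :
    X.hypSpline α (c • v) x = c * X.hypSpline α v x := by
  simp only [hypSpline, Prod.smul_fst, Prod.smul_snd, Pi.smul_apply, smul_eq_mul, mul_add,
    Finset.mul_sum, mul_assoc]
  ring

/-- The derivative of `hypSpline`. -/
noncomputable def hypSpline' (α : ℝ) (v : (Fin 3 → ℝ) × (Fin X.N → ℝ)) (x : ℝ) : ℝ :=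
  ((0 + α * v.1 1 + α * v.1 2 * (x - a)) * Real.cosh (α * (x - a)) +
    (v.1 2 + α * v.1 0 + α * 0 * (x - a)) * Real.sinh (α * (x - a))) +
    ∑ j : Fin X.N, v.2 j * (α ^ 2 * (max (x - X.x j.castSucc) 0) *
      Real.sinh (α * (max (x - X.x j.castSucc) 0)))

/-- The second derivative of `hypSpline`. -/
noncomputable def hypSpline'' (α : ℝ) (v : (Fin 3 → ℝ) × (Fin X.N → ℝ)) (x : ℝ) : ℝ :=
  ((α * v.1 2 + α * (v.1 2 + α * v.1 0) + α * (α * 0) * (x - a)) * Real.cosh (α * (x - a)) +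
    (α * 0 + α * (0 + α * v.1 1) + α * (α * v.1 2) * (x - a)) * Real.sinh (α * (x - a))) +
    ∑ j : Fin X.N, v.2 j * (α ^ 2 * (Real.sinh (α * (max (x - X.x j.castSucc) 0)) +
      α * (max (x - X.x j.castSucc) 0) * Real.cosh (α * (max (x - X.x j.castSucc) 0))))

theorem hasDerivAt_hypSpline (α : ℝ) (v : (Fin 3 → ℝ) × (Fin X.N → ℝ)) (x : ℝ) :
    HasDerivAt (X.hypSpline α v) (X.hypSpline' α v x) x :=
  ((hasDerivAt_poly_mul_hyp α _ _ _ _ (x - a)).comp_sub_const x a).add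
    (HasDerivAt.fun_sum fun j _ =>
      (HasDerivAt.truncate (hasDerivAt_hypKernel α) (by simp) (X.x j.castSucc) x).const_mul (v.2 j))

theorem hasDerivAt_hypSpline' (α : ℝ) (v : (Fin 3 → ℝ) × (Fin X.N → ℝ)) (x : ℝ) :
    HasDerivAt (X.hypSpline' α v) (X.hypSpline'' α v x) x :=
  ((hasDerivAt_poly_mul_hyp α _ _ _ _ (x - a)).comp_sub_const x a).add
    (HasDerivAt.fun_sum fun j _ => (HasDerivAt.truncate (hasDerivAt_deriv_hypKernel α) (by simp)
      (X.x j.castSucc) x).const_mul (v.2 j))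

/-- The kernel has a triple zero at `0`, so cutting it off there keeps two continuous derivatives.
-/
theorem contDiff_hypSpline (α : ℝ) (v : (Fin 3 → ℝ) × (Fin X.N → ℝ)) :
    ContDiff ℝ 2 (X.hypSpline α v) := by
  have hc : ContDiff ℝ (0 : ℕ) (X.hypSpline'' α v) := by
    rw [Nat.cast_zero, contDiff_zero]
    unfold hypSpline''
    fun_prop
  exact contDiff_succ_of_hasDerivAt (X.hasDerivAt_hypSpline α v)
    (contDiff_succ_of_hasDerivAt (X.hasDerivAt_hypSpline' α v) hc)

/-- Away from the nodes each truncated kernel is locally either a translated kernel or zero. -/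
theorem exists_isBihyperbolic_eventuallyEq (α : ℝ) (v : (Fin 3 → ℝ) × (Fin X.N → ℝ)) {x : ℝ}
    (hx : x ∉ range X.x) : ∃ g, IsBihyperbolic α g ∧ X.hypSpline α v =ᶠ[nhds x] g := by
  have hj : ∀ j : Fin X.N, ∃ g, IsBihyperbolic α g ∧
      ∀ᶠ y in nhds x, hypKernel α (max (y - X.x j.castSucc) 0) = g y := by
    intro j
    rcases lt_or_gt_of_ne (fun h => hx ⟨j.castSucc, h⟩ : X.x j.castSucc ≠ x) with h | h
    · refine ⟨_, (isBihyperbolic_hypKernel α).comp_sub_const (X.x j.castSucc), ?_⟩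
      filter_upwards [Ioi_mem_nhds h] with y hy
      rw [max_eq_left (by linarith [mem_Ioi.1 hy])]
    · refine ⟨_, IsBihyperbolic.zero, ?_⟩
      filter_upwards [Iio_mem_nhds h] with y hy
      rw [max_eq_right (by linarith [mem_Iio.1 hy]), hypKernel_zero]
  choose g hg hge using hj
  refine ⟨_, ((isBihyperbolic_poly_mul_hyp α (v.1 0) 0 (v.1 1) (v.1 2)).comp_sub_const a).add
    (IsBihyperbolic.sum Finset.univ fun j _ => (hg j).const_mul (v.2 j)), ?_⟩
  filter_upwards [Filter.eventually_all.2 hge] with y hy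
  simp only [hypSpline, hy]

theorem hypSpline_mem (α : ℝ) (v : (Fin 3 → ℝ) × (Fin X.N → ℝ)) :
    X.hypSpline α v ∈ polyhyperbolicSpline α 2 X := by
  have key : ContDiffOn ℝ 2 (X.hypSpline α v) (Icc a b) ∧
      ContDiffOn ℝ 4 (X.hypSpline α v) (Icc a b \ range X.x) ∧
      ∀ x ∈ Icc a b \ range X.x, ((hypOp α)^[2] (X.hypSpline α v)) x = 0 := by
    refine ⟨(X.contDiff_hypSpline α v).contDiffOn, fun x hx => ?_, fun x hx => ?_⟩
    · obtain ⟨g, hg, hge⟩ := X.exists_isBihyperbolic_eventuallyEq α v hx.2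
      exact (hg.contDiff.contDiffAt.congr_of_eventuallyEq hge).contDiffWithinAt
    · obtain ⟨g, hg, hge⟩ := X.exists_isBihyperbolic_eventuallyEq α v hx.2
      rw [hypOp_iterate_two α (hg.contDiff.contDiffAt.congr_of_eventuallyEq hge),
        hge.iteratedDeriv_eq, hge.iteratedDeriv_eq, hge.eq_of_nhds,
        ← hypOp_iterate_two α hg.contDiff.contDiffAt, hg.hypOp_iterate_two_eq_zero]
  exact key

/-- At `a` the kernels vanish with two derivatives, so the 2-jet there kills the three global
coefficients. Evaluation of the rest at the right ends of the subintervals is triangular, with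
positive diagonal by `hypKernel_pos`. -/
theorem hypSpline_injective (hab : a < b) {α : ℝ} (hα : 0 < α)
    {v : (Fin 3 → ℝ) × (Fin X.N → ℝ)} (hv : ∀ x ∈ Icc a b, X.hypSpline α v x = 0) : v = 0 := by
  have ha : a ∈ Icc a b := left_mem_Icc.2 hab.le
  have hder := iteratedDerivWithin_eq_of_hasDerivWithinAt hab
    (fun x _ => (X.hasDerivAt_hypSpline α v x).hasDerivWithinAt)
    (fun x _ => (X.hasDerivAt_hypSpline' α v x).hasDerivWithinAt) ha
  have hz : EqOn (X.hypSpline α v) (0 : ℝ → ℝ) (Icc a b) := hv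
  rw [iteratedDerivWithin_congr hz ha, iteratedDerivWithin_congr hz ha] at hder
  have hmax : ∀ j : Fin X.N, max (a - X.x j.castSucc) 0 = 0 := fun j =>
    max_eq_right (by linarith [(X.x_mem_Icc j.castSucc).1])
  have h0 := hv a ha
  obtain ⟨h1, h2⟩ := hder
  simp [hypSpline, hypSpline', hypSpline'', hmax, hα.ne'] at h0 h1 h2
  have h2' : v.1 2 = 0 := by
    rw [h0] at h2
    have : α * v.1 2 = 0 := by linarith
    exact (mul_eq_zero.1 this).resolve_left hα.ne'
  have hs : ∀ x ∈ Icc a b, ∑ j : Fin X.N, v.2 j * hypKernel α (max (x - X.x j.castSucc) 0) = 0 := by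
    intro x hx
    have := hv x hx
    simpa [hypSpline, h0, h1, h2'] using this
  have hc : ∀ j : Fin X.N, v.2 j = 0 := by
    intro j
    induction j using WellFoundedLT.induction with
    | ind j ih =>
      have h := hs _ (X.x_mem_Icc j.succ)
      rw [Finset.sum_eq_single j] at h
      · have hp := hypKernel_pos hα (sub_pos.2 (X.x_lt_succ j))
        rw [max_eq_left (sub_pos.2 (X.x_lt_succ j)).le] at h
        exact (mul_eq_zero.1 h).resolve_right hp.ne'
      · intro i _ hij
        rcases lt_or_gt_of_ne hij with h' | h'
        · rw [ih i h', zero_mul]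
        · have : X.x j.succ ≤ X.x i.castSucc :=
            X.strictMono.monotone (Fin.succ_le_castSucc_iff.2 h')
          rw [max_eq_right (by linarith), hypKernel_zero, mul_zero]
      · exact fun h => absurd (Finset.mem_univ j) h
  refine Prod.ext (funext fun i => ?_) (funext hc)
  fin_cases i
  exacts [h0, h1, h2']

end IntervalPartition

/-! ### Existence, uniqueness and error bounds for weighted interpolants. -/

/-- Existence of weighted splines with prescribed values at the nodes and prescribed derivatives
of order `m` at the ends, if the homogeneous problem has only the zero solution. -/
theorem IntervalPartition.exists_hypSpline {a b : ℝ} (X : IntervalPartition a b) (hab : a < b)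
    {α : ℝ} (hα : 0 < α) {w : ℝ → ℝ} (hw : AdmissibleWeight α w) {m : ℕ} (hm : m ≤ 2)
    (huniq : ∀ u ∈ polyhyperbolicSpline α 2 X, (∀ j, w (X.x j) * u (X.x j) = 0) →
      iteratedDerivWithin m (fun x => w x * u x) (Icc a b) a = 0 →
      iteratedDerivWithin m (fun x => w x * u x) (Icc a b) b = 0 → ∀ x ∈ Icc a b, u x = 0)
    (y : Fin (X.N + 1) → ℝ) (p q : ℝ) :
    ∃ u ∈ polyhyperbolicSpline α 2 X, (∀ j, w (X.x j) * u (X.x j) = y j) ∧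
      iteratedDerivWithin m (fun x => w x * u x) (Icc a b) a = p ∧
      iteratedDerivWithin m (fun x => w x * u x) (Icc a b) b = q := by
  have hud : UniqueDiffOn ℝ (Icc a b) := uniqueDiffOn_Icc hab
  have hcd : ∀ v, ∀ x ∈ Icc a b,
      ContDiffWithinAt ℝ m (fun x => w x * X.hypSpline α v x) (Icc a b) x := fun v x hx =>
    ((hw.contDiffOn_mul (X.contDiff_hypSpline α v).contDiffOn) x hx).of_le (by exact_mod_cast hm)
  have hadd : ∀ x ∈ Icc a b, ∀ v v',
      iteratedDerivWithin m (fun x => w x * X.hypSpline α (v + v') x) (Icc a b) x =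
      iteratedDerivWithin m (fun x => w x * X.hypSpline α v x) (Icc a b) x +
      iteratedDerivWithin m (fun x => w x * X.hypSpline α v' x) (Icc a b) x := by
    intro x hx v v'
    rw [← iteratedDerivWithin_fun_add hx hud (hcd v x hx) (hcd v' x hx)]
    simp only [X.hypSpline_add, mul_add]
  have hsmul : ∀ x ∈ Icc a b, ∀ (c : ℝ) v,
      iteratedDerivWithin m (fun x => w x * X.hypSpline α (c • v) x) (Icc a b) x =
      c * iteratedDerivWithin m (fun x => w x * X.hypSpline α v x) (Icc a b) x := by
    intro x hx c v
    rw [← iteratedDerivWithin_const_mul hx hud c (hcd v x hx)]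
    simp only [X.hypSpline_smul, mul_left_comm]
  have ha : a ∈ Icc a b := left_mem_Icc.2 hab.le
  have hb : b ∈ Icc a b := right_mem_Icc.2 hab.le
  let D : ((Fin 3 → ℝ) × (Fin X.N → ℝ)) →ₗ[ℝ] ((Fin (X.N + 1) → ℝ) × ℝ × ℝ) :=
    { toFun := fun v => (fun j => w (X.x j) * X.hypSpline α v (X.x j),
        iteratedDerivWithin m (fun x => w x * X.hypSpline α v x) (Icc a b) a,
        iteratedDerivWithin m (fun x => w x * X.hypSpline α v x) (Icc a b) b)
      map_add' := fun v v' => by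
        rw [hadd a ha, hadd b hb]
        refine Prod.ext (funext fun j => ?_) rfl
        simp only [X.hypSpline_add, mul_add, Prod.fst_add, Pi.add_apply]
      map_smul' := fun c v => by
        rw [hsmul a ha, hsmul b hb]
        refine Prod.ext (funext fun j => ?_) rfl
        simp only [X.hypSpline_smul, mul_left_comm, RingHom.id_apply, Prod.smul_fst,
          Pi.smul_apply, smul_eq_mul] }
  have hinj : Function.Injective D := by
    rw [injective_iff_map_eq_zero]
    intro v hv
    refine X.hypSpline_injective hab hα (huniq _ (X.hypSpline_mem α v) ?_ ?_ ?_)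
    · exact fun j => congrFun (congrArg Prod.fst hv) j
    · exact congrArg (fun z => z.2.1) hv
    · exact congrArg (fun z => z.2.2) hv
  -- The count is `3 + N = (N + 1) + 2`, so injectivity of `D` gives surjectivity.
  have hfr : Module.finrank ℝ ((Fin 3 → ℝ) × (Fin X.N → ℝ)) =
      Module.finrank ℝ ((Fin (X.N + 1) → ℝ) × ℝ × ℝ) := by
    simp
    omega
  obtain ⟨v, hv⟩ := (LinearMap.injective_iff_surjective_of_finrank_eq_finrank hfr).1 hinj (y, p, q)
  refine ⟨_, X.hypSpline_mem α v, ?_, ?_, ?_⟩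
  · exact fun j => congrFun (congrArg Prod.fst hv) j
  · exact congrArg (fun z => z.2.1) hv
  · exact congrArg (fun z => z.2.2) hv

/-- The products of the weight `w` with the second order polyhyperbolic splines. -/
def weightedSpline (w : ℝ → ℝ) (α : ℝ) {a b : ℝ} (X : IntervalPartition a b) : Set (ℝ → ℝ) :=
  {t | ∃ u ∈ polyhyperbolicSpline α 2 X, t = fun x => w x * u x}

/-- Serves twice: with `t` a second interpolant for uniqueness, and with `t = f` for the error. -/
theorem EndCondition.sub {a b : ℝ} (hab : a < b) {f s t : ℝ → ℝ}
    (hs : ContDiffOn ℝ 2 s (Icc a b)) (ht : ContDiffOn ℝ 2 t (Icc a b)) {e : EndType}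
    (hes : EndCondition a b f s e) (het : EndCondition a b f t e) :
    EndCondition a b 0 (s - t) e := by
  have hsub : ∀ m ≤ 2, ∀ x ∈ Icc a b, iteratedDerivWithin m (s - t) (Icc a b) x =
      iteratedDerivWithin m s (Icc a b) x - iteratedDerivWithin m t (Icc a b) x :=
    fun m hm x hx => iteratedDerivWithin_sub hx (uniqueDiffOn_Icc hab)
      ((hs x hx).of_le (by exact_mod_cast hm)) ((ht x hx).of_le (by exact_mod_cast hm))
  have ha : a ∈ Icc a b := left_mem_Icc.2 hab.le
  have hb : b ∈ Icc a b := right_mem_Icc.2 hab.le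
  have hz1 : ∀ c, iteratedDerivWithin 1 (0 : ℝ → ℝ) (Icc a b) c = 0 := by simp
  have hz2 : ∀ c, iteratedDerivWithin 2 (0 : ℝ → ℝ) (Icc a b) c = 0 := by simp
  cases e with
  | I =>
    exact ⟨by rw [hsub 1 one_le_two a ha, hes.1, het.1, sub_self, hz1],
      by rw [hsub 1 one_le_two b hb, hes.2, het.2, sub_self, hz1]⟩
  | II =>
    exact ⟨by rw [hsub 2 le_rfl a ha, hes.1, het.1, sub_self],
      by rw [hsub 2 le_rfl b hb, hes.2, het.2, sub_self]⟩
  | III =>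
    exact ⟨by rw [hsub 2 le_rfl a ha, hes.1, het.1, sub_self, hz2],
      by rw [hsub 2 le_rfl b hb, hes.2, het.2, sub_self, hz2]⟩

theorem derivSupNorm_le {a b C : ℝ} {i : ℕ} {u : ℝ → ℝ}
    (h : ∀ x ∈ Icc a b, |iteratedDerivWithin i u (Icc a b) x| ≤ C) :
    derivSupNorm a b i u ≤ ENNReal.ofReal C := by
  rw [derivSupNorm, eLpNorm_exponent_top]
  exact eLpNormEssSup_le_of_ae_bound (ae_restrict_of_forall_mem measurableSet_Icc h)

theorem InterpolationBound.mono {V : Set (ℝ → ℝ)} {a b : ℝ} (hab : a < b)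
    {X : IntervalPartition a b} {e : EndType} {f : ℝ → ℝ} {C C' : ℝ}
    (h : InterpolationBound V X e f C) (hC : C ≤ C') : InterpolationBound V X e f C' :=
  fun s hs i hi => (h s hs i hi).trans (ENNReal.ofReal_le_ofReal
    (mul_le_mul_of_nonneg_right hC (pow_nonneg (X.meshSize_pos hab).le _)))

/-- The constant depending on the partition exists as soon as the interpolant is unique. -/
theorem UniquelyInterpolable.exists_interpolationBound {V : Set (ℝ → ℝ)} {a b : ℝ} (hab : a < b)
    {X : IntervalPartition a b} {e : EndType} {f : ℝ → ℝ} (hf : ContDiffOn ℝ 2 f (Icc a b))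
    (hV : ∀ s ∈ V, ContDiffOn ℝ 2 s (Icc a b)) (h : UniquelyInterpolable V X e f) :
    ∃ C : ℝ, 0 < C ∧ InterpolationBound V X e f C := by
  obtain ⟨⟨t, ht⟩, huniq⟩ := h
  have hb : ∀ i : ℕ, i ≤ 2 →
      ∃ M, ∀ x ∈ Icc a b, |iteratedDerivWithin i (t - f) (Icc a b) x| ≤ M := fun i hi =>
    isCompact_Icc.exists_bound_of_continuousOn (((hV t ht.1).sub hf).continuousOn_iteratedDerivWithin
      (by exact_mod_cast hi) (uniqueDiffOn_Icc hab))
  obtain ⟨M0, h0⟩ := hb 0 (by norm_num)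
  obtain ⟨M1, h1⟩ := hb 1 (by norm_num)
  obtain ⟨M2, h2⟩ := hb 2 (by norm_num)
  set h := X.meshSize with hh
  have hpos : 0 < h := X.meshSize_pos hab
  set M := max 1 (max M0 (max M1 M2))
  have hM : 0 < M := lt_of_lt_of_le one_pos (le_max_left _ _)
  have hM' : ∀ i ≤ 2, ∀ x ∈ Icc a b, |iteratedDerivWithin i (t - f) (Icc a b) x| ≤ M := by
    intro i hi x hx
    interval_cases i
    · exact (h0 x hx).trans ((le_max_left _ _).trans (le_max_right _ _))
    · exact (h1 x hx).trans ((le_max_left _ _).trans ((le_max_right _ _).trans (le_max_right _ _)))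
    · exact (h2 x hx).trans ((le_max_right _ _).trans ((le_max_right _ _).trans (le_max_right _ _)))
  -- The sum dominates `M / h ^ (4 - i)` for all `i` at once.
  refine ⟨∑ n ∈ Finset.range 5, M / h ^ n,
    Finset.sum_pos (fun n _ => by positivity) ⟨0, by simp⟩, fun s hs i hi => derivSupNorm_le ?_⟩
  intro x hx
  have heq : EqOn (s - f) (t - f) (Icc a b) := fun y hy => by
    simp only [Pi.sub_apply, huniq s t hs ht hy]
  rw [iteratedDerivWithin_congr heq hx]
  refine (hM' i hi x hx).trans ?_
  have hle : M / h ^ (4 - i) ≤ ∑ n ∈ Finset.range 5, M / h ^ n :=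
    Finset.single_le_sum (f := fun n => M / h ^ n) (fun n _ => by positivity)
      (Finset.mem_range.2 (by omega))
  calc M = M / h ^ (4 - i) * h ^ (4 - i) := by field_simp
    _ ≤ _ := mul_le_mul_of_nonneg_right hle (by positivity)

namespace AdmissibleWeight

variable {α : ℝ} {w : ℝ → ℝ} {a b : ℝ}

theorem contDiffOn_of_mem (hw : AdmissibleWeight α w) {X : IntervalPartition a b} {t : ℝ → ℝ}
    (ht : t ∈ weightedSpline w α X) : ContDiffOn ℝ 2 t (Icc a b) := by
  obtain ⟨u, hu, rfl⟩ := ht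
  exact hw.contDiffOn_mul hu.1

/-- A weighted spline with homogeneous data vanishes. -/
theorem eq_zero_of_homogeneous (hw : AdmissibleWeight α w) (hab : a < b) (hα : 0 < α)
    (hα1 : α * (b - a) ≤ 1 / 16) {X : IntervalPartition a b} {e : EndType} {u : ℝ → ℝ}
    (hu : u ∈ polyhyperbolicSpline α 2 X) (h0 : ∀ j, u (X.x j) = 0)
    (he : EndCondition a b 0 (fun x => w x * u x) e) {x : ℝ} (hx : x ∈ Icc a b) : u x = 0 := by
  obtain ⟨B, -, hB⟩ := hw.exists_error_estimate hab hα hα1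
  have h := hB X e 0 u hu.1 hu.2.1 (fun y hy => by rw [hu.2.2 y hy, abs_zero]) h0 he 0
    (by norm_num) x hx
  rw [mul_zero, zero_mul, iteratedDerivWithin_zero] at h
  exact (mul_eq_zero.1 (abs_nonpos_iff.1 h)).resolve_left (hw.pos x).ne'

theorem _root_.sub_mem_polyhyperbolicSpline {X : IntervalPartition a b} {u v : ℝ → ℝ}
    (hu : u ∈ polyhyperbolicSpline α 2 X) (hv : v ∈ polyhyperbolicSpline α 2 X) :
    u - v ∈ polyhyperbolicSpline α 2 X := by
  refine ⟨hu.1.sub hv.1, hu.2.1.sub hv.2.1, fun x hx => ?_⟩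
  have hn := (X.compl_nodes_mem_nhds hx).2
  rw [hypOp_iterate_two_sub α (hu.2.1.contDiffAt hn) (hv.2.1.contDiffAt hn), hu.2.2 x hx,
    hv.2.2 x hx, sub_self]

/-- Both halves rest on the homogeneous problem having only the zero solution; existence adds the
dimension count. -/
theorem uniquelyInterpolable (hw : AdmissibleWeight α w) (hab : a < b) (hα : 0 < α)
    (hα1 : α * (b - a) ≤ 1 / 16) (X : IntervalPartition a b) (e : EndType) (f : ℝ → ℝ) :
    UniquelyInterpolable (weightedSpline w α X) X e f := by
  constructor
  · have hz : ∀ (m : ℕ) (c : ℝ), iteratedDerivWithin m (0 : ℝ → ℝ) (Icc a b) c = 0 := by simp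
    have huniq : ∀ e' : EndType, ∀ u ∈ polyhyperbolicSpline α 2 X,
        (∀ j, w (X.x j) * u (X.x j) = 0) → EndCondition a b 0 (fun x => w x * u x) e' →
        ∀ x ∈ Icc a b, u x = 0 := fun e' u hu h0 he x hx =>
      hw.eq_zero_of_homogeneous hab hα hα1 hu
        (fun j => (mul_eq_zero.1 (h0 j)).resolve_left (hw.pos _).ne') he hx
    cases e with
    | I =>
      obtain ⟨u, hu, h1, h2, h3⟩ := X.exists_hypSpline hab hα hw (m := 1) one_le_two
        (fun u hu h0 ha hb => huniq .I u hu h0 ⟨ha.trans (hz _ _).symm, hb.trans (hz _ _).symm⟩)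
        (fun j => f (X.x j)) (iteratedDerivWithin 1 f (Icc a b) a)
        (iteratedDerivWithin 1 f (Icc a b) b)
      exact ⟨_, ⟨u, hu, rfl⟩, h1, h2, h3⟩
    | II =>
      obtain ⟨u, hu, h1, h2, h3⟩ := X.exists_hypSpline hab hα hw (m := 2) le_rfl
        (fun u hu h0 ha hb => huniq .II u hu h0 ⟨ha, hb⟩) (fun j => f (X.x j)) 0 0
      exact ⟨_, ⟨u, hu, rfl⟩, h1, h2, h3⟩
    | III =>
      obtain ⟨u, hu, h1, h2, h3⟩ := X.exists_hypSpline hab hα hw (m := 2) le_rfl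
        (fun u hu h0 ha hb => huniq .II u hu h0 ⟨ha, hb⟩) (fun j => f (X.x j))
        (iteratedDerivWithin 2 f (Icc a b) a) (iteratedDerivWithin 2 f (Icc a b) b)
      exact ⟨_, ⟨u, hu, rfl⟩, h1, h2, h3⟩
  · rintro _ _ ⟨⟨u, hu, rfl⟩, h1, h2⟩ ⟨⟨v, hv, rfl⟩, k1, k2⟩ x hx
    have hend := EndCondition.sub hab (hw.contDiffOn_mul hu.1) (hw.contDiffOn_mul hv.1) h2 k2
    rw [show (fun x => w x * u x) - (fun x => w x * v x) = fun x => w x * (u - v) x from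
      funext fun x => by simp [mul_sub]] at hend
    have h := hw.eq_zero_of_homogeneous hab hα hα1 (sub_mem_polyhyperbolicSpline hu hv) (fun j => by
      have := (h1 j).trans (k1 j).symm
      exact sub_eq_zero.2 (mul_left_cancel₀ (hw.pos _).ne' this)) hend hx
    simp only [sub_eq_zero.1 h]

/-- The condition `he` is automatic for types I and III and means `f'' = 0` at both ends for type
II. It makes the end conditions of the error homogeneous, and `K` depends on `f / w` alone. -/
theorem exists_uniform_interpolationBound (hw : AdmissibleWeight α w) (hab : a < b) (hα : 0 < α)
    (hα1 : α * (b - a) ≤ 1 / 16) {f : ℝ → ℝ} (hf : ContDiffOn ℝ 4 f (Icc a b)) {e : EndType}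
    (he : EndCondition a b f f e) :
    ∃ C : ℝ, 0 < C ∧ ∀ X : IntervalPartition a b,
      InterpolationBound (weightedSpline w α X) X e f C := by
  have hF : ContDiffOn ℝ 4 (f / w) (Icc a b) := hw.contDiffOn_div hf
  obtain ⟨K, hK⟩ := exists_bound_hypOp_iterate_two hab α hF
  obtain ⟨B, hB, hest⟩ := hw.exists_error_estimate hab hα hα1
  refine ⟨B * |K| + 1, by positivity, fun X => ?_⟩
  rintro _ ⟨⟨u, hu, rfl⟩, h1, h2⟩ i hi
  have hend := EndCondition.sub hab (hw.contDiffOn_mul hu.1) (hf.of_le (by norm_num)) h2 he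
  have hrw : (fun x => w x * u x) - f = fun x => w x * (u - f / w) x := funext fun x => by
    have := (hw.pos x).ne'
    simp only [Pi.sub_apply, Pi.div_apply]
    field_simp
  rw [hrw] at hend ⊢
  refine derivSupNorm_le fun x hx => ?_
  refine (hest X e |K| (u - f / w) (hu.1.sub (hF.of_le (by norm_num)))
    (hu.2.1.sub (hF.mono sdiff_subset)) ?_ ?_ hend i hi x hx).trans
      (mul_le_mul_of_nonneg_right (by linarith) (pow_nonneg (X.meshSize_pos hab).le _))
  · intro y hy
    obtain ⟨hyo, hn⟩ := X.compl_nodes_mem_nhds hy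
    rw [hypOp_iterate_two_sub α (hu.2.1.contDiffAt hn)
      (hF.contDiffAt (Icc_mem_nhds hyo.1 hyo.2)), hu.2.2 y hy, zero_sub, abs_neg]
    exact (hK y hyo).trans (le_abs_self K)
  · intro j
    have := (hw.pos (X.x j)).ne'
    have h := h1 j
    simp only [Pi.sub_apply, Pi.div_apply, ← h]
    field_simp
    ring

end AdmissibleWeight

/-! ### The weights `1` and `sech`, and the conclusion. -/

theorem admissibleWeight_one {α : ℝ} (hα : 0 < α) : AdmissibleWeight α (fun _ => 1) :=
  ⟨contDiff_const, fun _ => one_pos, fun _ => by simpa using hα.le⟩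

/-- The logarithmic derivative is `-α tanh (α x)`, and `|sinh| ≤ cosh`. -/
theorem admissibleWeight_sech {α : ℝ} (hα : 0 < α) :
    AdmissibleWeight α (fun x => (Real.cosh (α * x))⁻¹) := by
  have hc : ∀ x : ℝ, Real.cosh (α * x) ≠ 0 := fun x => (Real.cosh_pos _).ne'
  refine ⟨?_, fun x => inv_pos.2 (Real.cosh_pos _), fun x => ?_⟩
  · exact (Real.contDiff_cosh.comp (contDiff_const.mul contDiff_id)).inv hc
  · have h : HasDerivAt (fun x => (Real.cosh (α * x))⁻¹)
        (-(α * Real.sinh (α * x)) / Real.cosh (α * x) ^ 2) x :=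
      (hasDerivAt_cosh_mul α x).inv (hc x)
    have hp := Real.cosh_pos (α * x)
    have hs : |Real.sinh (α * x)| ≤ Real.cosh (α * x) :=
      abs_le_of_sq_le_sq (by rw [Real.sinh_sq]; linarith) hp.le
    rw [h.deriv, abs_div, abs_neg, abs_mul, abs_of_pos hα, abs_of_pos (pow_pos hp 2),
      div_le_iff₀ (pow_pos hp 2)]
    have : α * (Real.cosh (α * x))⁻¹ * Real.cosh (α * x) ^ 2 = α * Real.cosh (α * x) := by
      field_simp
    rw [this]
    exact mul_le_mul_of_nonneg_left hs hα.le

theorem weightedSpline_one {α a b : ℝ} (X : IntervalPartition a b) :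
    weightedSpline (fun _ => 1) α X = polyhyperbolicSpline α 2 X := by
  ext t
  constructor
  · rintro ⟨u, hu, rfl⟩
    simpa using hu
  · exact fun ht => ⟨t, ht, by simp⟩

theorem weightedSpline_sech {α a b : ℝ} (X : IntervalPartition a b) :
    weightedSpline (fun x => (Real.cosh (α * x))⁻¹) α X = tanhSpline α 2 X := rfl

theorem mainTheorem5 (a b : ℝ) (hab : a < b) (f : ℝ → ℝ) (hf : ContDiffOn ℝ 4 f (Icc a b)) :
    ∃ α₀ : ℝ, 0 < α₀ ∧ ∀ α : ℝ, 0 < α → α < α₀ →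
      -- for every partition and every type of end conditions the interpolants are well defined,
      -- and the bounds hold with a constant depending on `α`, `f` and the partition
      (∀ (e : EndType) (X : IntervalPartition a b),
        UniquelyInterpolable (tanhSpline α 2 X) X e f ∧
        UniquelyInterpolable (polyhyperbolicSpline α 2 X) X e f ∧
        ∃ C : ℝ, 0 < C ∧ InterpolationBound (tanhSpline α 2 X) X e f C ∧
          InterpolationBound (polyhyperbolicSpline α 2 X) X e f C) ∧
      -- for end conditions which `f` itself satisfies, the constant depends on the partition
      -- only through its mesh ratio
      (∀ e : EndType, EndCondition a b f f e → ∀ ρ : ℝ, ∃ C : ℝ, 0 < C ∧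
        ∀ X : IntervalPartition a b, X.meshRatio ≤ ρ →
          InterpolationBound (tanhSpline α 2 X) X e f C ∧
          InterpolationBound (polyhyperbolicSpline α 2 X) X e f C) := by
  have hH : 0 < b - a := sub_pos.2 hab
  -- This threshold gives `α h ≤ 1 / 16` for every partition, as the absorption in the a priori
  -- estimate requires.
  refine ⟨1 / (16 * (b - a)), by positivity, fun α hα hα0 => ?_⟩
  have hα1 : α * (b - a) ≤ 1 / 16 := by
    rw [lt_div_iff₀ (by positivity)] at hα0
    linarith
  have hf2 : ContDiffOn ℝ 2 f (Icc a b) := hf.of_le (by norm_num)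
  have ht := admissibleWeight_sech hα
  have hs := admissibleWeight_one hα
  constructor
  · intro e X
    have ut := ht.uniquelyInterpolable hab hα hα1 X e f
    have us := hs.uniquelyInterpolable hab hα hα1 X e f
    obtain ⟨C, hC, hCt⟩ := ut.exists_interpolationBound hab hf2 fun _ => ht.contDiffOn_of_mem
    obtain ⟨C', -, hCs⟩ := us.exists_interpolationBound hab hf2 fun _ => hs.contDiffOn_of_mem
    rw [weightedSpline_sech] at ut hCt
    rw [weightedSpline_one] at us hCs
    exact ⟨ut, us, max C C', lt_max_of_lt_left hC, hCt.mono hab (le_max_left _ _),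
      hCs.mono hab (le_max_right _ _)⟩
  · intro e he ρ
    obtain ⟨C, hC, hCt⟩ := ht.exists_uniform_interpolationBound hab hα hα1 hf he
    obtain ⟨C', -, hCs⟩ := hs.exists_uniform_interpolationBound hab hα hα1 hf he
    refine ⟨max C C', lt_max_of_lt_left hC, fun X _ => ⟨?_, ?_⟩⟩
    · rw [← weightedSpline_sech]
      exact (hCt X).mono hab (le_max_left _ _)
    · rw [← weightedSpline_one]
      exact (hCs X).mono hab (le_max_right _ _)
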